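/- Fix $\alpha>2$, $\ell\in[0,1]$, $\lambda,c_1,c_2,P,\beta>0$, $\sigma_0\ge 0$ and an integer $N\ge 1$. Let $(X_i)_{i\in\mathbb N}$ be an enumeration of a homogeneous Poisson point process of density $\lambda$ on $\mathbb R^2$. Let $(\Theta_i,L_i)$ be i.i.d. marks, where $\Theta_i\in[0,\pi/2)$ almost surely has an arbitrary law (that of $\Theta$) and, given $\Theta_i$, the link to the origin is line-of-sight with probability $\rho(\Theta_i)=\frac{1}{1+c_2e^{-c_1\Theta_i}}$; $L_i=1$ if it is and $L_i=\ell$ otherwise. UAV $i$ is located at $U_i=(X_i,\|X_i\|\tan\Theta_i)\in\mathbb R^3$. Let the interference fading gains $G_i\sim\mathrm{Exp}(1)$ be i.i.d. and let $G_\star\sim\mathrm{Gamma}(N,1)$ (shape $N$, rate $1$), with the four families $(X_i)$, $(\Theta_i,L_i)$, $(G_i)$, $G_\star$ mutually independent (the angle-projection-independent, APIL, scenario with $N$-antenna UAVs). The typical user at the origin is served by the UAV with the strongest average received power, of index $\star=\arg\max_i P\,\mathbb E[G_i]\,L_i\|U_i\|^{-\alpha}$, and its downlink coverage is $$p_{cov}=\mathbb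 P\left[\frac{P\,G_\star L_\star\|U_\star\|^{-\alpha}}{I_0+\sigma_0}\ge\beta\right],\qquad I_0=\sum_{i\ne\star}P\,G_iL_i\|U_i\|^{-\alpha}.$$ Put $$\omega=\mathbb E\left[\cos^2(\Theta)\left(\rho(\Theta)(1-\ell^{2/\alpha})+\ell^{2/\alpha}\right)\right],\qquad \mathcal I_G(u,v)=u^v\left(\frac{\pi v}{\sin(\pi v)}-\int_0^{u^{-v}}\frac{dr}{1+r^{1/v}}\right).$$ Then $\omega>0$, the maximizing index $\star$ is almost surely unique and well defined, and, with $D_\star\sim\mathrm{Exp}(\pi\lambda\omega)$ (rate $\pi\lambda\omega$), $$p_{cov}=\frac{d^{N-1}}{dt^{N-1}}\,\mathbb E\left[\frac{t^{N-1}}{(N-1)!}\exp\left(-\frac{\sigma_0D_\star^{\alpha/2}}{tP}-\pi\lambda\omega D_\star\,\mathcal I_G\left(\frac1t,\frac2\alpha\right)\right)\right]\Bigg|_{t=1/\beta},$$ where for every $t>0$ the random variable inside the expectation is integrable, and the expectation is $N-1$ times continuously differentiable in $t\in(0,\infty)$. -/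

import Mathlib

open MeasureTheory ProbabilityTheory Set
open scoped ENNReal NNReal

namespace UAVNet

/-- The ground plane `ℝ²` with its Euclidean norm and Lebesgue measure. -/
abbrev Plane := EuclideanSpace ℝ (Fin 2)

/-- Three-dimensional space `ℝ² × ℝ` with its Euclidean norm. -/
abbrev Space3 := WithLp 2 (Plane × ℝ)

/-- Number of indices `i` with `X i ω ∈ A`: the counting measure of the random points `X i`,
evaluated at the set `A`. -/
noncomputable def count {Ω : Type*} (X : ℕ → Ω → Plane) (A : Set Plane) (ω : Ω) : ℕ∞ :=
  Set.encard {i : ℕ | X i ω ∈ A}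

/-- `(X i)` is a measurable enumeration of a homogeneous Poisson point process of density `lam`
on the plane: the number of points in a Borel set `A` of finite area `|A|` is Poisson distributed
with mean `lam * |A|`, and the numbers of points in disjoint such sets are independent.
(Points are counted with multiplicity, so that almost sure simplicity of the process is a
consequence.) -/
structure IsHomogeneousPPP {Ω : Type*} [MeasurableSpace Ω] (μ : Measure Ω)
    (X : ℕ → Ω → Plane) (lam : ℝ) : Prop where
  measurable : ∀ i, Measurable (X i)
  poisson : ∀ A : Set Plane, MeasurableSet A → volume A < ∞ → ∀ n : ℕ,
    μ {ω | count X A ω = (n : ℕ∞)} = poissonMeasure (lam * volume.real A).toNNReal {n}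
  indep : ∀ (k : ℕ) (A : Fin k → Set Plane), (∀ j, MeasurableSet (A j)) →
    (∀ j, volume (A j) < ∞) → Pairwise (fun j j' => Disjoint (A j) (A j')) →
    iIndepFun (fun j => count X (A j)) μ

/-- The line-of-sight probability `1 / (1 + c₂ exp (-c₁ θ))` at elevation angle `θ`. -/
noncomputable def losProb (c₁ c₂ θ : ℝ) : ℝ := 1 / (1 + c₂ * Real.exp (-c₁ * θ))

/-- The random elements of the network on the sample space `Ω`: ground projections `X i` of the
UAVs, their elevation angles `Θ i` seen from the origin, the indicators `los i` of a line-of-sight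
link to the origin, the interference fading gains `G i`, and the fading gain `Gserv` of the
link from the serving UAV. -/
structure Network (Ω : Type*) where
  X : ℕ → Ω → Plane
  Θ : ℕ → Ω → ℝ
  los : ℕ → Ω → Bool
  G : ℕ → Ω → ℝ
  Gserv : Ω → ℝ

namespace Network

variable {Ω : Type*}

/-- The position `(X i, H i)` of UAV `i`, with altitude `H i = ‖X i‖ tan (Θ i)`. -/
noncomputable def U (net : Network Ω) (i : ℕ) (ω : Ω) : Space3 :=
  WithLp.toLp 2 (net.X i ω, ‖net.X i ω‖ * Real.tan (net.Θ i ω))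

/-- The channel factor `L i`: `1` for a line-of-sight link and `ell` otherwise. -/
noncomputable def L (net : Network Ω) (ell : ℝ) (i : ℕ) (ω : Ω) : ℝ :=
  if net.los i ω = true then 1 else ell

/-- The average (over the fading) power `P 𝔼[G i] L i ‖U i‖ ^ (-α)` received from UAV `i`. -/
noncomputable def avgPower [MeasurableSpace Ω] (net : Network Ω) (μ : Measure Ω)
    (α ell P : ℝ) (i : ℕ) (ω : Ω) : ℝ :=
  P * (∫ ω', net.G i ω' ∂μ) * net.L ell i ω * ‖net.U i ω‖ ^ (-α)

/-- Index `i` attains the maximum of the average received powers. -/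
def IsStrongest [MeasurableSpace Ω] (net : Network Ω) (μ : Measure Ω)
    (α ell P : ℝ) (ω : Ω) (i : ℕ) : Prop :=
  ∀ j, net.avgPower μ α ell P j ω ≤ net.avgPower μ α ell P i ω

/-- The index of the UAV serving the typical user at the origin:
the `arg max` of the average received powers. -/
noncomputable def star [MeasurableSpace Ω] (net : Network Ω) (μ : Measure Ω)
    (α ell P : ℝ) (ω : Ω) : ℕ :=
  Classical.epsilon (net.IsStrongest μ α ell P ω)

/-- The interference power `I₀`: the sum over all UAVs except the serving one of
`P G i L i ‖U i‖ ^ (-α)`, as an element of `[0, ∞]`. -/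
noncomputable def interference [MeasurableSpace Ω] (net : Network Ω) (μ : Measure Ω)
    (α ell P : ℝ) (ω : Ω) : ℝ≥0∞ :=
  ∑' i : ℕ, if i = net.star μ α ell P ω then 0
    else ENNReal.ofReal (P * net.G i ω * net.L ell i ω * ‖net.U i ω‖ ^ (-α))

/-- The power `P Gserv L⋆ ‖U⋆‖ ^ (-α)` of the signal from the serving UAV. -/
noncomputable def signal [MeasurableSpace Ω] (net : Network Ω) (μ : Measure Ω)
    (α ell P : ℝ) (ω : Ω) : ℝ :=
  P * net.Gserv ω * net.L ell (net.star μ α ell P ω) ω *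
    ‖net.U (net.star μ α ell P ω) ω‖ ^ (-α)

/-- The signal-to-interference-plus-noise ratio of the typical user. -/
noncomputable def sinr [MeasurableSpace Ω] (net : Network Ω) (μ : Measure Ω)
    (α ell P σ₀ : ℝ) (ω : Ω) : ℝ≥0∞ :=
  ENNReal.ofReal (net.signal μ α ell P ω) /
    (net.interference μ α ell P ω + ENNReal.ofReal σ₀)

/-- The downlink coverage probability: the probability that the SINR is at least `β`. -/
noncomputable def coverage [MeasurableSpace Ω] (net : Network Ω) (μ : Measure Ω)
    (α ell P σ₀ β : ℝ) : ℝ :=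
  μ.real {ω | ENNReal.ofReal β ≤ net.sinr μ α ell P σ₀ ω}

/-- The angle-projection-independent scenario. The projections form a homogeneous Poisson point
process of density `lam`; the pairs (elevation angle, line-of-sight indicator) are i.i.d., the
angle having law `ν` and the link being line-of-sight with conditional probability
`losProb c₁ c₂ θ` given angle `θ`; the interference gains are i.i.d. `Exp(1)` and the serving gain
is `Gamma(N, 1)`; the projections, the (angle, line-of-sight) pairs, the interference gains and
the serving gain are mutually independent. -/
structure IsAPIL [MeasurableSpace Ω] (net : Network Ω) (μ : Measure Ω) (lam c₁ c₂ : ℝ)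
    (ν : Measure ℝ) (N : ℕ) : Prop where
  ppp : IsHomogeneousPPP μ net.X lam
  measurable_Θ : ∀ i, Measurable (net.Θ i)
  measurable_los : ∀ i, Measurable (net.los i)
  measurable_G : ∀ i, Measurable (net.G i)
  measurable_Gserv : Measurable net.Gserv
  law_Θ : ∀ i, HasLaw (net.Θ i) ν μ
  los_given_Θ : ∀ i, ∀ A : Set ℝ, MeasurableSet A →
    μ {ω | net.Θ i ω ∈ A ∧ net.los i ω = true} = ∫⁻ θ in A, ENNReal.ofReal (losProb c₁ c₂ θ) ∂ν
  indep_marks : iIndepFun (fun i ω => (net.Θ i ω, net.los i ω)) μ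
  law_G : ∀ i, HasLaw (net.G i) (expMeasure 1) μ
  indep_G : iIndepFun net.G μ
  law_Gserv : HasLaw net.Gserv (gammaMeasure N 1) μ
  indep_X_marks : IndepFun (fun ω i => net.X i ω) (fun ω i => (net.Θ i ω, net.los i ω)) μ
  indep_G_rest : IndepFun (fun ω i => net.G i ω)
    (fun ω => ((fun i => net.X i ω), (fun i => (net.Θ i ω, net.los i ω)))) μ
  indep_Gserv_rest : IndepFun net.Gserv
    (fun ω => ((fun i => net.G i ω), (fun i => net.X i ω),
      (fun i => (net.Θ i ω, net.los i ω)))) μ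

end Network

/-- `ω = 𝔼[cos²(Θ) (ρ(Θ) (1 - ℓ^(2/α)) + ℓ^(2/α))]`, where `Θ` has law `ν` and `ρ` is the
line-of-sight probability. -/
noncomputable def omega (α ell c₁ c₂ : ℝ) (ν : Measure ℝ) : ℝ :=
  ∫ θ, Real.cos θ ^ 2 * (losProb c₁ c₂ θ * (1 - ell ^ (2 / α)) + ell ^ (2 / α)) ∂ν

/-- `I_G(u, v) = u^v (π v / sin (π v) - ∫_0^{u^{-v}} dr / (1 + r^{1/v}))`. -/
noncomputable def IG (u v : ℝ) : ℝ :=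
  u ^ v * (Real.pi * v / Real.sin (Real.pi * v) -
    ∫ r in (0 : ℝ)..(u ^ (-v)), 1 / (1 + r ^ (1 / v)))

/-- The random variable, as a function of the value `D` of `D⋆`, whose expectation is
differentiated in the coverage formula; `w` stands for `ω`. -/
noncomputable def covIntegrand (N : ℕ) (α lam P σ₀ w t D : ℝ) : ℝ :=
  t ^ (N - 1) / ((N - 1).factorial : ℝ) *
    Real.exp (-(σ₀ * D ^ (α / 2)) / (t * P) - Real.pi * lam * w * D * IG (1 / t) (2 / α))

/-- The expectation of `covIntegrand` for `D⋆ ∼ Exp(π lam w)`. -/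
noncomputable def covExpectation (N : ℕ) (α lam P σ₀ w t : ℝ) : ℝ :=
  ∫ D, covIntegrand N α lam P σ₀ w t D ∂(expMeasure (Real.pi * lam * w))

end UAVNet

/-! Put `W i = L i ^ (2/α) cos² (Θ i) / ‖X i‖²`. Since `‖U i‖ = ‖X i‖ / cos (Θ i)`, the average
power of UAV `i` is `P * W i ^ (α/2)`, so altitude, angle and line of sight enter only through `W
i`. Area in the plane is linear in the squared radius, and independent marks may be averaged out of
a Poisson process. Hence the points `1 / W i` behave as a Poisson process on the half-line of
constant rate `c = π λ ω`, with independent `Exp(1)` marks. This is expressed through the Laplace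
functional (`IsPoissonGain`), which is all that is used afterwards. Void probabilities, finiteness
of the points in bounded intervals and absence of ties follow from it, whence the unique strongest
UAV (`ae_exists_max`).

Let `D = 1 / max W`, and let the load `T` be interference plus noise divided by `P * (max W) ^
(α/2)`. Given `D = d`, the points beyond `d` are still Poisson, and an `Exp(1)` mark turns a term of
size `x` into the factor `1 / (1 + x)`; a substitution produces `IG`. Conditioning on `D` is
replaced by a mesh: the event that the nearest point lies in `(a, b]` is a difference of two void
events, on each of which the Laplace functional is explicit, and the mesh width then tends to `0`.
The outcome is `lintegral_expNeg_totalLoad`, the formula for `𝔼 exp (-T / t)`.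

The serving gain is independent of `T`, so coverage is `𝔼[gammaTail (N - 1) (β T)]`. The identity
`d^m/dt^m (t^m / m! · e^{-y/t}) = gammaTail m (y / t)`, taken under the expectation
(`iteratedDeriv_pow_mul_meanTail`), converts the Laplace transform into this tail at `t = 1 / β`.

Sums and exponents live in `[0, ∞]` with `exp (-∞) = 0`. No convergence of the interference has to
be proved, and an infinite exponent encodes the indicator of a void event. -/

open Filter Topology

namespace UAVNet

/-! ### The exponential `exp (-x)` on `[0, ∞]` -/

/-- `exp (-x)` for an extended nonnegative real `x`. -/
noncomputable def expNeg (x : ℝ≥0∞) : ℝ≥0∞ := EReal.exp (-(x : EReal))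

/-- `-log y` as an extended nonnegative real; inverse to `expNeg` on `[0, 1]`. -/
noncomputable def negLog (y : ℝ≥0∞) : ℝ≥0∞ := (-(ENNReal.log y)).toENNReal

@[simp] lemma expNeg_zero : expNeg 0 = 1 := by simp [expNeg]

@[simp] lemma expNeg_top : expNeg ∞ = 0 := by simp [expNeg]

lemma expNeg_ofReal {x : ℝ} (hx : 0 ≤ x) :
    expNeg (ENNReal.ofReal x) = ENNReal.ofReal (Real.exp (-x)) := by
  rw [expNeg, EReal.coe_ennreal_ofReal, max_eq_left hx, ← EReal.coe_neg, EReal.exp_coe]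

lemma expNeg_of_ne_top {x : ℝ≥0∞} (hx : x ≠ ∞) :
    expNeg x = ENNReal.ofReal (Real.exp (-x.toReal)) := by
  rw [← expNeg_ofReal ENNReal.toReal_nonneg, ENNReal.ofReal_toReal hx]

lemma expNeg_add (x y : ℝ≥0∞) : expNeg (x + y) = expNeg x * expNeg y := by
  rw [expNeg, expNeg, expNeg, ← EReal.exp_add, EReal.coe_ennreal_add, EReal.neg_add, sub_eq_add_neg]
  · left; exact EReal.coe_ennreal_ne_bot _
  · right; exact EReal.coe_ennreal_ne_bot _

lemma continuous_expNeg : Continuous expNeg :=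
  ENNReal.continuous_exp.comp (continuous_neg.comp continuous_coe_ennreal_ereal)

@[fun_prop] lemma measurable_expNeg : Measurable expNeg := continuous_expNeg.measurable

lemma antitone_expNeg : Antitone expNeg := fun x y h => by
  unfold expNeg
  exact EReal.exp_monotone (EReal.neg_le_neg_iff.2 (EReal.coe_ennreal_le_coe_ennreal_iff.2 h))

lemma expNeg_le_one (x : ℝ≥0∞) : expNeg x ≤ 1 := by
  simpa using antitone_expNeg (zero_le (a := x))

lemma expNeg_ne_top (x : ℝ≥0∞) : expNeg x ≠ ∞ := ne_top_of_le_ne_top ENNReal.one_ne_top (expNeg_le_one x)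

lemma expNeg_negLog {y : ℝ≥0∞} (hy : y ≤ 1) : expNeg (negLog y) = y := by
  rw [expNeg, negLog, EReal.coe_toENNReal, neg_neg, ENNReal.exp_log]
  rw [EReal.le_neg, neg_zero]
  simpa using hy

@[fun_prop] lemma measurable_negLog : Measurable negLog := by
  unfold negLog
  exact measurable_ereal_toENNReal.comp (ENNReal.continuous_log.neg.measurable)

lemma expNeg_sum {ι : Type*} (s : Finset ι) (f : ι → ℝ≥0∞) :
    expNeg (∑ i ∈ s, f i) = ∏ i ∈ s, expNeg (f i) := by
  classical
  induction s using Finset.induction_on with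
  | empty => simp
  | insert a s ha ih => rw [Finset.sum_insert ha, Finset.prod_insert ha, expNeg_add, ih]

lemma expNeg_mul_natCast (c : ℝ≥0∞) (n : ℕ) : expNeg (c * n) = expNeg c ^ n := by
  have := expNeg_sum (Finset.range n) (fun _ => c)
  simpa [mul_comm] using this

lemma tendsto_prod_expNeg (f : ℕ → ℝ≥0∞) :
    Tendsto (fun n => ∏ i ∈ Finset.range n, expNeg (f i)) atTop (𝓝 (expNeg (∑' i, f i))) := by
  simp_rw [← expNeg_sum]
  exact (continuous_expNeg.tendsto _).comp (ENNReal.tendsto_nat_tsum f)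

/-! ### Laplace transform of the Poisson law -/

section Poisson

variable {Ω : Type*} [MeasurableSpace Ω] {μ : Measure Ω} [IsProbabilityMeasure μ]

/-- The hypothesis says nothing about the value `⊤`; its mass is zero on both sides because the
finite values already carry the total mass of the Poisson law. -/
lemma map_eq_map_poissonMeasure {N : Ω → ℕ∞} (hN : AEMeasurable N μ) {r : ℝ≥0}
    (h : ∀ n : ℕ, μ {ω | N ω = n} = poissonMeasure r {n}) :
    μ.map N = (poissonMeasure r).map (fun n : ℕ => (n : ℕ∞)) := by
  have hc : Measurable (fun n : ℕ => (n : ℕ∞)) := Measurable.of_discrete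
  have : IsProbabilityMeasure (μ.map N) := Measure.isProbabilityMeasure_map hN
  have : IsProbabilityMeasure ((poissonMeasure r).map (fun n : ℕ => (n : ℕ∞))) :=
    Measure.isProbabilityMeasure_map hc.aemeasurable
  have key : ∀ n : ℕ, μ.map N {(n : ℕ∞)} =
      ((poissonMeasure r).map (fun n : ℕ => (n : ℕ∞))) {(n : ℕ∞)} := by
    intro n
    rw [Measure.map_apply_of_aemeasurable hN (measurableSet_singleton _),
      Measure.map_apply hc (measurableSet_singleton _)]
    have : (fun n : ℕ => (n : ℕ∞)) ⁻¹' {(n : ℕ∞)} = {n} := by ext; simp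
    rw [this, ← h n]
    rfl
  refine Measure.ext_of_singleton fun a => ?_
  rcases eq_or_ne a ⊤ with rfl | ha
  · have hs : ({⊤} : Set ℕ∞) = (⋃ n : ℕ, {(n : ℕ∞)})ᶜ := by
      ext x
      simp only [mem_singleton_iff, mem_compl_iff, mem_iUnion, not_exists]
      constructor
      · rintro rfl n; exact (ENat.natCast_ne_top n).symm
      · intro hx; by_contra hne
        exact hx x.toNat (ENat.natCast_toNat hne).symm
    have hd : Pairwise (Function.onFun Disjoint fun n : ℕ => ({(n : ℕ∞)} : Set ℕ∞)) := by
      intro i j hij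
      simpa [Function.onFun] using hij
    have hm : MeasurableSet (⋃ n : ℕ, {(n : ℕ∞)}) := MeasurableSet.of_discrete
    rw [hs, prob_compl_eq_one_sub hm, prob_compl_eq_one_sub hm,
      measure_iUnion hd (fun _ => measurableSet_singleton _),
      measure_iUnion hd (fun _ => measurableSet_singleton _)]
    simp_rw [key]
  · lift a to ℕ using ha
    exact key a

/-- With `p = exp (-c)` this is the generating series `∑ p^n e^{-r} r^n / n!`. The case `c = ∞` is
`p = 0`, with `0 ^ 0 = 1`, and yields the void probability. -/
lemma lintegral_expNeg_poisson (r : ℝ≥0) (c : ℝ≥0∞) :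
    ∫⁻ n : ℕ, expNeg (c * n) ∂(poissonMeasure r) = expNeg (r * (1 - expNeg c)) := by
  simp_rw [expNeg_mul_natCast]
  obtain ⟨p, hp⟩ : ∃ p : ℝ≥0, expNeg c = p := ⟨(expNeg c).toNNReal, (ENNReal.coe_toNNReal (expNeg_ne_top c)).symm⟩
  have hp1 : (p : ℝ) ≤ 1 := by
    have := expNeg_le_one c
    rw [hp] at this
    exact_mod_cast this
  rw [hp, lintegral_countable']
  simp_rw [poissonMeasure_singleton]
  have hs : HasSum (fun n : ℕ => (p : ℝ) ^ n * (Real.exp (-r) * r ^ n / n.factorial))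
      (Real.exp (-(r * (1 - p)))) := by
    have h1 := NormedSpace.expSeries_div_hasSum_exp (𝔸 := ℝ) ((r : ℝ) * p)
    rw [← Real.exp_eq_exp_ℝ] at h1
    have h2 := h1.mul_left (Real.exp (-r))
    rw [← Real.exp_add] at h2
    have e1 : -(r : ℝ) + r * p = -(r * (1 - p)) := by ring
    rw [e1] at h2
    refine h2.congr_fun fun n => ?_
    rw [mul_pow]; ring
  have e : (r : ℝ≥0∞) * (1 - p) = ENNReal.ofReal (r * (1 - p)) := by
    rw [ENNReal.ofReal_mul r.coe_nonneg, ENNReal.ofReal_sub _ p.coe_nonneg]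
    simp
  rw [e, expNeg_ofReal (mul_nonneg r.coe_nonneg (sub_nonneg.2 hp1)), ← hs.tsum_eq,
    ENNReal.ofReal_tsum_of_nonneg (fun n => by positivity) hs.summable]
  congr 1 with n
  rw [ENNReal.ofReal_mul (by positivity), ENNReal.ofReal_pow p.coe_nonneg]
  simp

lemma lintegral_expNeg_of_poisson {N : Ω → ℕ∞} (hN : AEMeasurable N μ) {r : ℝ≥0}
    (h : ∀ n : ℕ, μ {ω | N ω = n} = poissonMeasure r {n}) (c : ℝ≥0∞) :
    ∫⁻ ω, expNeg (c * (N ω : ℝ≥0∞)) ∂μ = expNeg (r * (1 - expNeg c)) := by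
  have hm : Measurable (fun x : ℕ∞ => expNeg (c * (x : ℝ≥0∞))) := Measurable.of_discrete
  rw [← lintegral_map' (f := fun x : ℕ∞ => expNeg (c * (x : ℝ≥0∞))) hm.aemeasurable hN,
    map_eq_map_poissonMeasure hN h, lintegral_map hm Measurable.of_discrete]
  simpa using lintegral_expNeg_poisson r c

end Poisson

/-! ### Laplace functionals of Poisson processes and of marked sequences -/

lemma toENNReal_count {Ω : Type*} (X : ℕ → Ω → Plane) (A : Set Plane) (ω : Ω) :
    (count X A ω : ℝ≥0∞) = ∑' i, A.indicator (fun _ => (1 : ℝ≥0∞)) (X i ω) := by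
  rw [count, ← ENNReal.tsum_set_one, tsum_subtype {i | X i ω ∈ A} (fun _ => (1 : ℝ≥0∞))]
  rfl

section

variable {Ω : Type*} [MeasurableSpace Ω] {μ : Measure Ω}

lemma measurable_count {X : ℕ → Ω → Plane} (hX : ∀ i, Measurable (X i)) {A : Set Plane}
    (hA : MeasurableSet A) : Measurable (count X A) := by
  have h : Measurable (fun ω => (count X A ω : ℝ≥0∞)) := by
    simp_rw [toENNReal_count]
    exact Measurable.tsum fun i => (measurable_const.indicator hA).comp (hX i)
  refine measurable_to_countable' fun n => ?_
  have : count X A ⁻¹' {n} = (fun ω => (count X A ω : ℝ≥0∞)) ⁻¹' {(n : ℝ≥0∞)} := by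
    ext ω; simp
  rw [this]
  exact h (measurableSet_singleton _)

variable [IsProbabilityMeasure μ]

lemma IsHomogeneousPPP.lintegral_expNeg_count {X : ℕ → Ω → Plane} {lam : ℝ} (hlam : 0 < lam)
    (h : IsHomogeneousPPP μ X lam) {A : Set Plane} (hA : MeasurableSet A) (hA' : volume A < ∞)
    (c : ℝ≥0∞) :
    ∫⁻ ω, expNeg (c * (count X A ω : ℝ≥0∞)) ∂μ =
      expNeg (ENNReal.ofReal lam * (volume A * (1 - expNeg c))) := by
  rw [lintegral_expNeg_of_poisson (measurable_count h.measurable hA).aemeasurable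
    (h.poisson A hA hA'), ← mul_assoc]
  congr 2
  change ENNReal.ofReal (lam * volume.real A) = _
  rw [ENNReal.ofReal_mul hlam.le, measureReal_def, ENNReal.ofReal_toReal hA'.ne]

/-- Laplace functional of a Poisson process on simple functions supported on sets of finite area. -/
lemma IsHomogeneousPPP.lintegral_expNeg_simpleFunc {X : ℕ → Ω → Plane} {lam : ℝ} (hlam : 0 < lam)
    (h : IsHomogeneousPPP μ X lam) (f : SimpleFunc Plane ℝ≥0∞)
    (hf : ∀ c ∈ f.range, c ≠ 0 → volume (f ⁻¹' {c}) < ∞) :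
    ∫⁻ ω, expNeg (∑' i, f (X i ω)) ∂μ =
      expNeg (ENNReal.ofReal lam * ∫⁻ x, (1 - expNeg (f x))) := by
  classical
  set S := f.range.filter (· ≠ 0) with hS
  have hfin : ∀ c : S, volume (f ⁻¹' {c.1}) < ∞ := fun c => by
    have := Finset.mem_filter.1 c.2
    exact hf c.1 this.1 this.2
  -- One expansion over the nonzero level sets serves twice: for `f` itself and for `1 - exp (-f)`.
  have hrep : ∀ F : ℝ≥0∞ → ℝ≥0∞, F 0 = 0 → ∀ x,
      F (f x) = ∑ c : S, F c.1 * (f ⁻¹' {c.1}).indicator (fun _ => 1) x := by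
    intro F hF x
    rw [Finset.sum_coe_sort S (fun c => F c * (f ⁻¹' {c}).indicator (fun _ => 1) x)]
    by_cases hx : f x = 0
    · rw [hx, hF, Finset.sum_eq_zero]
      intro c hc
      have hc0 : c ≠ 0 := (Finset.mem_filter.1 hc).2
      rw [indicator_of_notMem, mul_zero]
      simp only [mem_preimage, mem_singleton_iff, hx]
      exact hc0.symm
    · rw [Finset.sum_eq_single (f x)]
      · simp
      · intro c _ hc
        rw [indicator_of_notMem, mul_zero]
        simpa using hc.symm
      · intro hx'
        exact absurd (Finset.mem_filter.2 ⟨f.mem_range_self x, hx⟩) hx'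
  have hmeas : ∀ c : S, MeasurableSet (f ⁻¹' {c.1}) := fun c => f.measurableSet_preimage _
  have hsum : ∀ ω, ∑' i, f (X i ω) = ∑ c : S, c.1 * (count X (f ⁻¹' {c.1}) ω : ℝ≥0∞) := by
    intro ω
    simp_rw [toENNReal_count, ← ENNReal.tsum_mul_left]
    rw [← Summable.tsum_finsetSum (fun _ _ => ENNReal.summable)]
    exact tsum_congr fun i => hrep id rfl _
  -- Independence of counts is assumed for families indexed by `Fin k`, hence the relabelling of the
  -- nonzero values of `f`.
  let e := (Fintype.equivFin S).symm
  have hind : iIndepFun (fun c : S => count X (f ⁻¹' {c.1})) μ := by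
    have h1 := h.indep (Fintype.card S) (fun j => f ⁻¹' {(e j).1}) (fun j => hmeas _)
      (fun j => hfin _) (fun i j hij => by
        refine Disjoint.preimage f ?_
        rw [disjoint_singleton]
        exact fun h' => hij (e.injective (Subtype.ext h')))
    have h2 := h1.precomp (Fintype.equivFin S).injective
    simpa [e] using h2
  have hind' := hind.comp (fun c : S => fun n : ℕ∞ => expNeg (c.1 * (n : ℝ≥0∞)))
    (fun _ => Measurable.of_discrete)
  simp_rw [hsum, expNeg_sum]
  have := lintegral_prod_eq_prod_lintegral_of_indepFun Finset.univ _ hind'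
    (fun c => Measurable.of_discrete.comp (measurable_count h.measurable (hmeas c)))
  simp only [Function.comp_apply] at this
  rw [this]
  simp_rw [fun c : S => h.lintegral_expNeg_count hlam (hmeas c) (hfin c) c.1]
  rw [← expNeg_sum, ← Finset.mul_sum]
  congr 2
  have : ∀ x, 1 - expNeg (f x) =
      ∑ c : S, (1 - expNeg c.1) * (f ⁻¹' {c.1}).indicator (fun _ => 1) x :=
    hrep (fun y => 1 - expNeg y) (by simp)
  simp_rw [this]
  rw [lintegral_finsetSum _ (fun c _ => (measurable_const.indicator (hmeas c)).const_mul _)]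
  refine Finset.sum_congr rfl fun c _ => ?_
  rw [lintegral_const_mul _ (measurable_const.indicator (hmeas c)),
    lintegral_indicator (hmeas c), setLIntegral_one, mul_comm]

/-- Laplace functional of a homogeneous Poisson process. -/
theorem IsHomogeneousPPP.lintegral_expNeg_tsum {X : ℕ → Ω → Plane} {lam : ℝ} (hlam : 0 < lam)
    (h : IsHomogeneousPPP μ X lam) {f : Plane → ℝ≥0∞} (hf : Measurable f) :
    ∫⁻ ω, expNeg (∑' i, f (X i ω)) ∂μ =
      expNeg (ENNReal.ofReal lam * ∫⁻ x, (1 - expNeg (f x))) := by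
  -- The cut-off to a ball gives every nonzero level set finite area while keeping the approximation
  -- increasing to `f`.
  let g : ℕ → SimpleFunc Plane ℝ≥0∞ := fun n =>
    (SimpleFunc.eapprox f n).restrict (Metric.ball 0 n)
  have hg : ∀ n x, g n x = (Metric.ball (0 : Plane) n).indicator (SimpleFunc.eapprox f n) x :=
    fun n x => by rw [SimpleFunc.restrict_apply _ Metric.isOpen_ball.measurableSet]
  have hmono : Monotone fun n x => g n x := by
    intro m n hmn x
    simp only [hg]
    refine indicator_le_indicator' ?_ |>.trans (indicator_le_indicator_of_subset
      (Metric.ball_subset_ball (by exact_mod_cast hmn)) (fun _ => zero_le) x)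
    exact fun _ => SimpleFunc.monotone_eapprox f hmn x
  have hsup : ∀ x, ⨆ n, g n x = f x := by
    intro x
    refine le_antisymm (iSup_le fun n => ?_) ?_
    · rw [hg]
      refine (indicator_le_self _ _ x).trans ?_
      rw [← SimpleFunc.iSup_eapprox_apply hf x]
      exact le_iSup (fun n => SimpleFunc.eapprox f n x) n
    · rw [← SimpleFunc.iSup_eapprox_apply hf x]
      refine iSup_le fun n => ?_
      obtain ⟨k, hk⟩ := exists_nat_gt ‖x‖
      refine le_iSup_of_le (max n k) ?_
      rw [hg, indicator_of_mem]
      · exact SimpleFunc.monotone_eapprox f (le_max_left n k) x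
      · rw [mem_ball_zero_iff]
        exact hk.trans_le (by exact_mod_cast le_max_right n k)
  have hgt : ∀ x, Tendsto (fun n => g n x) atTop (𝓝 (f x)) := fun x => by
    rw [← hsup x]; exact tendsto_atTop_iSup fun m n hmn => hmono hmn x
  have hstep : ∀ n, ∫⁻ ω, expNeg (∑' i, g n (X i ω)) ∂μ =
      expNeg (ENNReal.ofReal lam * ∫⁻ x, (1 - expNeg (g n x))) := by
    intro n
    refine h.lintegral_expNeg_simpleFunc hlam _ fun c _ hc => ?_
    refine (measure_mono ?_).trans_lt (measure_ball_lt_top (x := (0 : Plane)) (r := n))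
    intro x hx
    by_contra hx'
    rw [mem_preimage, mem_singleton_iff, hg, indicator_of_notMem hx'] at hx
    exact hc hx.symm
  have hL : Tendsto (fun n => ∫⁻ ω, expNeg (∑' i, g n (X i ω)) ∂μ) atTop
      (𝓝 (∫⁻ ω, expNeg (∑' i, f (X i ω)) ∂μ)) := by
    refine tendsto_lintegral_of_dominated_convergence (fun _ => 1) (fun n => ?_)
      (fun n => ae_of_all _ fun ω => expNeg_le_one _) (by simp) (ae_of_all _ fun ω => ?_)
    · exact measurable_expNeg.comp (Measurable.tsum fun i => (g n).measurable.comp (h.measurable i))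
    · refine (continuous_expNeg.tendsto _).comp ?_
      have : ∑' i, f (X i ω) = ⨆ n, ∑' i, g n (X i ω) := by
        simp_rw [← hsup, ← lintegral_count]
        exact lintegral_iSup (fun n => .of_discrete) fun m n hmn i => hmono hmn _
      rw [this]
      exact tendsto_atTop_iSup fun m n hmn => ENNReal.tsum_le_tsum fun i => hmono hmn _
  have hR : Tendsto (fun n => expNeg (ENNReal.ofReal lam * ∫⁻ x, (1 - expNeg (g n x)))) atTop
      (𝓝 (expNeg (ENNReal.ofReal lam * ∫⁻ x, (1 - expNeg (f x))))) := by
    refine (continuous_expNeg.tendsto _).comp (ENNReal.Tendsto.const_mul ?_ (Or.inr (by simp)))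
    refine lintegral_tendsto_of_tendsto_of_monotone (fun n => ?_) (ae_of_all _ fun x => ?_)
      (ae_of_all _ fun x => ?_)
    · exact (measurable_const.sub (measurable_expNeg.comp (g n).measurable)).aemeasurable
    · exact fun m n hmn => tsub_le_tsub_left (antitone_expNeg (hmono hmn x)) _
    · exact ENNReal.Tendsto.sub tendsto_const_nhds ((continuous_expNeg.tendsto _).comp (hgt x))
        (Or.inl (by simp))
  refine tendsto_nhds_unique hL ?_
  simp_rw [hstep]
  exact hR

/-- Averaging out independent marks in the Laplace functional of a marked sequence. -/
theorem lintegral_expNeg_tsum_marks {S T : Type*} [MeasurableSpace S] [MeasurableSpace T]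
    {A : ℕ → Ω → S} {B : ℕ → Ω → T} (hA : ∀ i, Measurable (A i)) (hB : ∀ i, Measurable (B i))
    (hAB : IndepFun (fun ω i => A i ω) (fun ω i => B i ω) μ) (hind : iIndepFun B μ)
    {f : S × T → ℝ≥0∞} (hf : Measurable f) {r : S → ℝ≥0∞}
    (hr : ∀ i a, ∫⁻ ω, expNeg (f (a, B i ω)) ∂μ = r a) :
    ∫⁻ ω, expNeg (∑' i, f (A i ω, B i ω)) ∂μ = ∫⁻ ω, expNeg (∑' i, negLog (r (A i ω))) ∂μ := by
  have hA' : Measurable (fun ω i => A i ω) := measurable_pi_lambda _ hA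
  have hB' : Measurable (fun ω i => B i ω) := measurable_pi_lambda _ hB
  have hr1 : ∀ a, r a ≤ 1 := fun a => by
    rw [← hr 0 a]
    calc _ ≤ ∫⁻ _, 1 ∂μ := lintegral_mono fun _ => expNeg_le_one _
      _ = 1 := by simp
  let F : (ℕ → S) × (ℕ → T) → ℝ≥0∞ := fun p => expNeg (∑' i, f (p.1 i, p.2 i))
  have hF : Measurable F := by
    refine measurable_expNeg.comp (Measurable.tsum fun i => hf.comp ?_)
    exact ((measurable_pi_apply i).comp measurable_fst).prodMk
      ((measurable_pi_apply i).comp measurable_snd)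
  -- Independence of the two sequences splits the expectation into an iterated integral. For a
  -- frozen first sequence, the finite products factor by independence of the marks, and dominated
  -- convergence by `1` reaches the infinite product.
  have h1 : ∫⁻ ω, expNeg (∑' i, f (A i ω, B i ω)) ∂μ =
      ∫⁻ ω, ∫⁻ ω', F ((fun i => A i ω), (fun i => B i ω')) ∂μ ∂μ := by
    have e := (indepFun_iff_map_prod_eq_prod_map_map hA'.aemeasurable hB'.aemeasurable).1 hAB
    calc _ = ∫⁻ p, F p ∂(μ.map fun ω => ((fun i => A i ω), (fun i => B i ω))) :=
          (lintegral_map hF (hA'.prodMk hB')).symm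
      _ = _ := by
        have := Measure.isProbabilityMeasure_map (μ := μ) hB'.aemeasurable
        rw [e, lintegral_prod _ hF.aemeasurable, lintegral_map hF.lintegral_prod_right' hA']
        refine lintegral_congr fun ω => ?_
        exact lintegral_map (hF.comp measurable_prodMk_left) hB'
  rw [h1]
  refine lintegral_congr fun ω => ?_
  have hL : Tendsto (fun n => ∫⁻ ω', ∏ i ∈ Finset.range n, expNeg (f (A i ω, B i ω')) ∂μ) atTop
      (𝓝 (∫⁻ ω', F ((fun i => A i ω), (fun i => B i ω')) ∂μ)) := by
    refine tendsto_lintegral_of_dominated_convergence (fun _ => 1) (fun n => ?_)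
      (fun n => ae_of_all _ fun ω => Finset.prod_le_one' fun i _ => expNeg_le_one _) (by simp)
      (ae_of_all _ fun ω' => tendsto_prod_expNeg _)
    exact Finset.measurable_prod _ fun i _ =>
      measurable_expNeg.comp (hf.comp (measurable_const.prodMk (hB i)))
  refine tendsto_nhds_unique hL ?_
  have hR := tendsto_prod_expNeg fun i => negLog (r (A i ω))
  refine hR.congr fun n => ?_
  have hi := hind.comp (fun i b => expNeg (f (A i ω, b)))
    (fun i => measurable_expNeg.comp (hf.comp measurable_prodMk_left))
  have := lintegral_prod_eq_prod_lintegral_of_indepFun (Finset.range n) _ hi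
    (fun i => measurable_expNeg.comp (hf.comp (measurable_const.prodMk (hB i))))
  simp only [Function.comp_apply] at this
  rw [this]
  exact Finset.prod_congr rfl fun i _ => by rw [expNeg_negLog (hr1 _), hr]

end

/-! ### Squared distance as a coordinate -/

lemma volume_plane_closedBall_sqrt (b : ℝ) (hb : 0 ≤ b) :
    volume (Metric.closedBall (0 : Plane) (√b)) = ENNReal.ofReal (Real.pi * b) := by
  rw [EuclideanSpace.volume_closedBall_fin_two, ← ENNReal.ofReal_pow (Real.sqrt_nonneg b),
    Real.sq_sqrt hb, mul_comm, ENNReal.ofReal_mul Real.pi_pos.le]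

/-- The disc `‖x‖² ≤ w b` has area `π w b`, which is linear in `b`, so the image of area has
constant density. Half-open intervals determine the measure. -/
lemma map_norm_sq_div_volume {w : ℝ} (hw : 0 < w) :
    (volume : Measure Plane).map (fun x => ‖x‖ ^ 2 / w) =
      ENNReal.ofReal (Real.pi * w) • volume.restrict (Ioi 0) := by
  have hm : Measurable (fun x : Plane => ‖x‖ ^ 2 / w) := by fun_prop
  have hIic : ∀ b : ℝ, 0 ≤ b →
      volume ((fun x : Plane => ‖x‖ ^ 2 / w) ⁻¹' Iic b) = ENNReal.ofReal (Real.pi * w * b) := by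
    intro b hb
    rw [mul_assoc, ← volume_plane_closedBall_sqrt _ (by positivity : 0 ≤ w * b)]
    congr 1
    ext x
    rw [mem_preimage, mem_Iic, mem_closedBall_zero_iff, div_le_iff₀ hw,
      Real.le_sqrt (norm_nonneg x) (by positivity), mul_comm]
  have hneg : ∀ a : ℝ, a < 0 → (fun x : Plane => ‖x‖ ^ 2 / w) ⁻¹' Iic a = ∅ := by
    intro a ha
    ext x
    simp only [mem_preimage, mem_Iic, mem_empty_iff_false, iff_false, not_le]
    exact ha.trans_le (by positivity)
  have hval : ∀ a b : ℝ, a < b → (volume : Measure Plane).map (fun x => ‖x‖ ^ 2 / w) (Ioc a b) =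
      ENNReal.ofReal (Real.pi * w * (max b 0 - max a 0)) := by
    intro a b hab
    rw [Measure.map_apply hm measurableSet_Ioc, ← Iic_sdiff_Iic, preimage_sdiff]
    rcases lt_or_ge b 0 with hb | hb
    · rw [hneg b hb]
      simp [max_eq_right hb.le, max_eq_right (hab.trans hb).le]
    rcases lt_or_ge a 0 with ha | ha
    · rw [hneg a ha, sdiff_empty, hIic b hb, max_eq_left hb, max_eq_right ha.le, sub_zero]
    · rw [measure_sdiff (preimage_mono (Iic_subset_Iic.2 hab.le))
        (hm measurableSet_Iic).nullMeasurableSet (by rw [hIic a ha]; exact ENNReal.ofReal_ne_top),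
        hIic b hb, hIic a ha, ← ENNReal.ofReal_sub _ (by positivity), max_eq_left hb,
        max_eq_left ha, mul_sub]
  refine Measure.ext_of_Ioc' _ _ (fun a b hab => ?_) fun a b hab => ?_
  · rw [hval a b hab]; exact ENNReal.ofReal_ne_top
  · rw [hval a b hab, Measure.smul_apply, Measure.restrict_apply measurableSet_Ioc, smul_eq_mul,
      ENNReal.ofReal_mul (by positivity)]
    congr 1
    rcases lt_or_ge b 0 with hb | hb
    · have : Ioc a b ∩ Ioi 0 = ∅ := by
        ext x; simp only [mem_inter_iff, mem_Ioc, mem_Ioi, mem_empty_iff_false, iff_false]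
        intro h; linarith [h.1.2, h.2]
      rw [this]; simp [max_eq_right hb.le, max_eq_right (hab.trans hb).le]
    · rw [Ioc_inter_Ioi, Real.volume_Ioc, max_eq_left hb]

/-- The value `w = 0` has to be allowed, since a link that is not line-of-sight has weight zero when
`ell = 0`; this is where `F 0 = 0` is needed. -/
lemma lintegral_comp_div_norm_sq {w : ℝ} (hw : 0 ≤ w) {F : ℝ → ℝ≥0∞} (hF : Measurable F)
    (hF0 : F 0 = 0) :
    ∫⁻ x : Plane, F (w / ‖x‖ ^ 2) =
      ENNReal.ofReal (Real.pi * w) * ∫⁻ s in Ioi (0 : ℝ), F (1 / s) := by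
  rcases hw.eq_or_lt with rfl | hw
  · simp [hF0]
  · have hm : Measurable (fun x : Plane => ‖x‖ ^ 2 / w) := by fun_prop
    have hF' : Measurable (fun s : ℝ => F (1 / s)) := hF.comp (by fun_prop)
    rw [← smul_eq_mul, ← lintegral_smul_measure, ← map_norm_sq_div_volume hw,
      lintegral_map hF' hm]
    simp

/-! ### The mark law and its mean weight -/

/-- The law of a pair (elevation angle, line-of-sight indicator). -/
noncomputable def markLaw (c₁ c₂ : ℝ) (ν : Measure ℝ) : Measure (ℝ × Bool) :=
  (ν.withDensity fun θ => ENNReal.ofReal (losProb c₁ c₂ θ)).map (fun θ => (θ, true)) +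
    (ν.withDensity fun θ => 1 - ENNReal.ofReal (losProb c₁ c₂ θ)).map (fun θ => (θ, false))

lemma losProb_pos {c₁ c₂ : ℝ} (hc₂ : 0 < c₂) (θ : ℝ) : 0 < losProb c₁ c₂ θ := by
  unfold losProb; positivity

lemma losProb_le_one {c₁ c₂ : ℝ} (hc₂ : 0 < c₂) (θ : ℝ) : losProb c₁ c₂ θ ≤ 1 := by
  unfold losProb
  rw [div_le_one (by positivity)]
  linarith [mul_pos hc₂ (Real.exp_pos (-c₁ * θ))]

@[fun_prop] lemma measurable_losProb (c₁ c₂ : ℝ) : Measurable (losProb c₁ c₂) := by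
  unfold losProb; fun_prop

/-- The factor `L ^ (2/α) cos² Θ` of a UAV with mark `m = (Θ, los)`. -/
noncomputable def weight (α ell : ℝ) (m : ℝ × Bool) : ℝ :=
  (if m.2 = true then 1 else ell) ^ (2 / α) * Real.cos m.1 ^ 2

@[fun_prop] lemma measurable_weight (α ell : ℝ) : Measurable (weight α ell) := by
  unfold weight
  have : MeasurableSet {m : ℝ × Bool | m.2 = true} :=
    measurable_snd (measurableSet_singleton true)
  exact ((Measurable.ite this measurable_const measurable_const).pow_const _).mul (by fun_prop)

lemma weight_nonneg {α ell : ℝ} (hell : 0 ≤ ell) (m : ℝ × Bool) : 0 ≤ weight α ell m := by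
  unfold weight
  split_ifs <;> positivity

lemma lintegral_markLaw {c₁ c₂ : ℝ} {ν : Measure ℝ} {F : ℝ × Bool → ℝ≥0∞} (hF : Measurable F) :
    ∫⁻ m, F m ∂(markLaw c₁ c₂ ν) =
      ∫⁻ θ, (ENNReal.ofReal (losProb c₁ c₂ θ) * F (θ, true) +
        (1 - ENNReal.ofReal (losProb c₁ c₂ θ)) * F (θ, false)) ∂ν := by
  have m1 : Measurable fun θ => F (θ, true) := hF.comp (by fun_prop)
  have m2 : Measurable fun θ => F (θ, false) := hF.comp (by fun_prop)
  have m3 : Measurable fun θ => ENNReal.ofReal (losProb c₁ c₂ θ) := by fun_prop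
  have m4 : Measurable fun θ => 1 - ENNReal.ofReal (losProb c₁ c₂ θ) := measurable_const.sub m3
  rw [markLaw, lintegral_add_measure, lintegral_map hF (by fun_prop),
    lintegral_map hF (by fun_prop), lintegral_withDensity_eq_lintegral_mul _ m3 m1,
    lintegral_withDensity_eq_lintegral_mul _ m4 m2,
    ← lintegral_add_left (by exact m3.mul m1)]
  rfl

/-- This identifies `ω` as the mean weight of a mark, the constant that ends up in the rate of the
process of points `1 / W i`. -/
lemma lintegral_weight_markLaw {α ell c₁ c₂ : ℝ} {ν : Measure ℝ} [IsFiniteMeasure ν]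
    (hell : ell ∈ Icc (0 : ℝ) 1) (hc₂ : 0 < c₂) :
    ∫⁻ m, ENNReal.ofReal (weight α ell m) ∂(markLaw c₁ c₂ ν) =
      ENNReal.ofReal (omega α ell c₁ c₂ ν) := by
  have he := Real.rpow_nonneg hell.1 (2 / α)
  rw [lintegral_markLaw (by fun_prop), omega, ofReal_integral_eq_lintegral_ofReal]
  · refine lintegral_congr fun θ => ?_
    have h0 := (losProb_pos (c₁ := c₁) hc₂ θ).le
    have h1 := losProb_le_one (c₁ := c₁) hc₂ θ
    rw [← ENNReal.ofReal_one, ← ENNReal.ofReal_sub _ h0, ← ENNReal.ofReal_mul h0,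
      ← ENNReal.ofReal_mul (sub_nonneg.2 h1), ← ENNReal.ofReal_add]
    · congr 1
      simp [weight]
      ring
    · exact mul_nonneg h0 (weight_nonneg hell.1 _)
    · exact mul_nonneg (sub_nonneg.2 h1) (weight_nonneg hell.1 _)
  · refine Integrable.of_bound (C := 1 * (1 * (1 + ell ^ (2 / α)) + ell ^ (2 / α)))
      (Measurable.aestronglyMeasurable (by fun_prop)) (ae_of_all _ fun θ => ?_)
    have h0 := (losProb_pos (c₁ := c₁) hc₂ θ).le
    have h1 := losProb_le_one (c₁ := c₁) hc₂ θ
    rw [norm_mul, norm_pow]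
    refine mul_le_mul ?_ ?_ (norm_nonneg _) zero_le_one
    · exact pow_le_one₀ (norm_nonneg _) (Real.abs_cos_le_one θ)
    · refine (norm_add_le _ _).trans (add_le_add ?_ (by rw [Real.norm_of_nonneg he]))
      rw [norm_mul, Real.norm_of_nonneg h0]
      refine mul_le_mul h1 ?_ (norm_nonneg _) zero_le_one
      refine (norm_sub_le _ _).trans (by rw [Real.norm_of_nonneg he]; simp)
  · refine ae_of_all _ fun θ => ?_
    have h0 := (losProb_pos (c₁ := c₁) hc₂ θ).le
    have h1 := losProb_le_one (c₁ := c₁) hc₂ θ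
    have : 0 ≤ losProb c₁ c₂ θ + (1 - losProb c₁ c₂ θ) * ell ^ (2 / α) :=
      add_nonneg h0 (mul_nonneg (sub_nonneg.2 h1) he)
    change 0 ≤ Real.cos θ ^ 2 * (losProb c₁ c₂ θ * (1 - ell ^ (2 / α)) + ell ^ (2 / α))
    refine mul_nonneg (sq_nonneg _) (by linarith)

/-! ### Reduction of the network to a marked Poisson process on the half-line -/

namespace Network

variable {Ω : Type*}

/-- The mark (elevation angle, line-of-sight indicator) of UAV `i`. -/
def mark (net : Network Ω) (i : ℕ) (ω : Ω) : ℝ × Bool := (net.Θ i ω, net.los i ω)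

/-- The normalized power `L i ^ (2/α) cos² (Θ i) / ‖X i‖²`. -/
noncomputable def gain (net : Network Ω) (α ell : ℝ) (i : ℕ) (ω : Ω) : ℝ :=
  weight α ell (net.mark i ω) / ‖net.X i ω‖ ^ 2

lemma gain_nonneg (net : Network Ω) {α ell : ℝ} (hell : 0 ≤ ell) (i : ℕ) (ω : Ω) :
    0 ≤ net.gain α ell i ω := div_nonneg (weight_nonneg hell _) (by positivity)

variable [MeasurableSpace Ω] {μ : Measure Ω} {net : Network Ω} {lam c₁ c₂ : ℝ} {ν : Measure ℝ}
  {N : ℕ}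

lemma IsAPIL.measurable_mark (h : net.IsAPIL μ lam c₁ c₂ ν N) (i : ℕ) : Measurable (net.mark i) :=
  (h.measurable_Θ i).prodMk (h.measurable_los i)

lemma IsAPIL.measurable_gain (h : net.IsAPIL μ lam c₁ c₂ ν N) (α ell : ℝ) (i : ℕ) :
    Measurable (net.gain α ell i) :=
  ((measurable_weight α ell).comp (h.measurable_mark i)).div
    ((h.ppp.measurable i).norm.pow_const 2)

variable [IsProbabilityMeasure μ]

lemma IsAPIL.isProbabilityMeasure (h : net.IsAPIL μ lam c₁ c₂ ν N) : IsProbabilityMeasure ν := by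
  rw [← (h.law_Θ 0).map_eq]
  exact Measure.isProbabilityMeasure_map (h.law_Θ 0).aemeasurable

lemma IsAPIL.map_mark (h : net.IsAPIL μ lam c₁ c₂ ν N) (hc₂ : 0 < c₂) (i : ℕ) :
    μ.map (net.mark i) = markLaw c₁ c₂ ν := by
  have := h.isProbabilityMeasure
  have m3 : Measurable fun θ => ENNReal.ofReal (losProb c₁ c₂ θ) := by fun_prop
  have hν : ∀ A, MeasurableSet A → μ {ω | net.Θ i ω ∈ A} = ν A := fun A hA => by
    rw [← (h.law_Θ i).map_eq, Measure.map_apply (h.measurable_Θ i) hA]; rfl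
  have hfalse : ∀ A : Set ℝ, MeasurableSet A → μ {ω | net.Θ i ω ∈ A ∧ net.los i ω = false} =
      ∫⁻ θ in A, (1 - ENNReal.ofReal (losProb c₁ c₂ θ)) ∂ν := by
    intro A hA
    have hlt : ∫⁻ θ in A, ENNReal.ofReal (losProb c₁ c₂ θ) ∂ν ≠ ∞ := by
      rw [← h.los_given_Θ i A hA]; exact measure_ne_top _ _
    rw [lintegral_sub m3 hlt (ae_of_all _ fun θ => by
        simpa using losProb_le_one hc₂ θ), setLIntegral_one, ← h.los_given_Θ i A hA, ← hν A hA,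
      ← measure_sdiff _ _ (measure_ne_top _ _)]
    · congr 1
      ext ω
      simp only [mem_ofPred_eq, Set.mem_sdiff, not_and, Bool.not_eq_true]
      tauto
    · exact fun ω hω => hω.1
    · exact ((h.measurable_Θ i hA).inter
        (h.measurable_los i (measurableSet_singleton true))).nullMeasurableSet
  ext S hS
  have hSt : MeasurableSet ((fun θ : ℝ => (θ, true)) ⁻¹' S) := (by fun_prop : Measurable _) hS
  have hSf : MeasurableSet ((fun θ : ℝ => (θ, false)) ⁻¹' S) := (by fun_prop : Measurable _) hS
  rw [Measure.map_apply (h.measurable_mark i) hS, markLaw, Measure.add_apply,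
    Measure.map_apply (by fun_prop) hS, Measure.map_apply (by fun_prop) hS,
    withDensity_apply _ hSt, withDensity_apply _ hSf, ← h.los_given_Θ i _ hSt, ← hfalse _ hSf,
    ← measure_union]
  · congr 1
    ext ω
    rcases hb : net.los i ω with _ | _ <;> simp [mark, hb]
  · rw [Set.disjoint_left]
    rintro ω ⟨_, h1⟩ ⟨_, h2⟩
    rw [h1] at h2
    exact absurd h2 (by decide)
  · exact (h.measurable_Θ i hSf).inter (h.measurable_los i (measurableSet_singleton false))

/-- Laplace functional of the marked process of normalized powers and fading gains. -/
theorem IsAPIL.lintegral_expNeg_tsum (h : net.IsAPIL μ lam c₁ c₂ ν N) {α ell : ℝ}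
    (hlam : 0 < lam) (hell : ell ∈ Icc (0 : ℝ) 1) (hc₂ : 0 < c₂) {F : ℝ × ℝ → ℝ≥0∞}
    (hF : Measurable F) (hF0 : ∀ g, F (0, g) = 0) :
    ∫⁻ ω, expNeg (∑' i, F (net.gain α ell i ω, net.G i ω)) ∂μ =
      expNeg (ENNReal.ofReal (Real.pi * lam * omega α ell c₁ c₂ ν) *
        ∫⁻ s in Ioi (0 : ℝ), (1 - ∫⁻ g, expNeg (F (1 / s, g)) ∂(expMeasure 1))) := by
  have hν := h.isProbabilityMeasure
  have hexp : IsProbabilityMeasure (expMeasure 1) := isProbabilityMeasure_expMeasure one_pos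
  have hmk : IsProbabilityMeasure (markLaw c₁ c₂ ν) := by
    rw [← h.map_mark hc₂ 0]
    exact Measure.isProbabilityMeasure_map (h.measurable_mark 0).aemeasurable
  set ρ : ℝ → ℝ≥0∞ := fun W => ∫⁻ g, expNeg (F (W, g)) ∂(expMeasure 1) with hρ
  have hρm : Measurable ρ := (measurable_expNeg.comp hF).lintegral_prod_right'
  have hρ1 : ∀ W, ρ W ≤ 1 := fun W => by
    calc _ ≤ ∫⁻ _, 1 ∂(expMeasure 1) := lintegral_mono fun _ => expNeg_le_one _
      _ = 1 := by simp
  have hρ0 : ρ 0 = 1 := by simp [hρ, hF0]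
  have hdiv : Measurable fun p : Plane × (ℝ × Bool) => weight α ell p.2 / ‖p.1‖ ^ 2 := by fun_prop
  -- The fading is averaged first, given projections and marks. The result `ρ` of a single average
  -- is put back into the exponent through `negLog`, so that the same lemma applies again.
  have step1 : ∫⁻ ω, expNeg (∑' i, F (net.gain α ell i ω, net.G i ω)) ∂μ =
      ∫⁻ ω, expNeg (∑' i, negLog (ρ (net.gain α ell i ω))) ∂μ := by
    refine lintegral_expNeg_tsum_marks (A := net.gain α ell) (B := net.G)
      (fun i => h.measurable_gain α ell i) h.measurable_G ?_ h.indep_G hF (r := ρ) fun i a => ?_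
    · have hφ : Measurable fun p : (ℕ → Plane) × (ℕ → ℝ × Bool) =>
          fun i => weight α ell (p.2 i) / ‖p.1 i‖ ^ 2 :=
        measurable_pi_lambda _ fun i => by
          have : Measurable fun p : (ℕ → Plane) × (ℕ → ℝ × Bool) => (p.1 i, p.2 i) := by fun_prop
          exact hdiv.comp this
      exact (h.indep_G_rest.symm.comp hφ measurable_id)
    · change _ = ∫⁻ g, expNeg (F (a, g)) ∂(expMeasure 1)
      rw [← (h.law_G i).map_eq, lintegral_map _ (h.measurable_G i)]
      exact measurable_expNeg.comp (hF.comp measurable_prodMk_left)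
  set r : Plane → ℝ≥0∞ := fun x => ∫⁻ m, ρ (weight α ell m / ‖x‖ ^ 2) ∂(markLaw c₁ c₂ ν) with hr
  have hrm : Measurable r := (hρm.comp hdiv).lintegral_prod_right'
  have hr1 : ∀ x, r x ≤ 1 := fun x => by
    calc _ ≤ ∫⁻ _, 1 ∂(markLaw c₁ c₂ ν) := lintegral_mono fun _ => hρ1 _
      _ = 1 := by simp
  -- The angles and line-of-sight indicators are averaged next, given the projections, leaving a
  -- function of the planar Poisson process alone.
  have step2 : ∫⁻ ω, expNeg (∑' i, negLog (ρ (net.gain α ell i ω))) ∂μ =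
      ∫⁻ ω, expNeg (∑' i, negLog (r (net.X i ω))) ∂μ := by
    refine lintegral_expNeg_tsum_marks (A := net.X) (B := net.mark) h.ppp.measurable
      h.measurable_mark h.indep_X_marks h.indep_marks
      (f := fun p => negLog (ρ (weight α ell p.2 / ‖p.1‖ ^ 2)))
      (measurable_negLog.comp (hρm.comp hdiv)) (r := r) fun i x => ?_
    change _ = ∫⁻ m, ρ (weight α ell m / ‖x‖ ^ 2) ∂(markLaw c₁ c₂ ν)
    rw [← h.map_mark hc₂ i, lintegral_map _ (h.measurable_mark i)]
    · exact lintegral_congr fun ω => expNeg_negLog (hρ1 _)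
    · exact hρm.comp (hdiv.comp measurable_prodMk_left)
  rw [step1, step2,
    h.ppp.lintegral_expNeg_tsum (f := fun x => negLog (r x)) hlam (measurable_negLog.comp hrm)]
  simp_rw [expNeg_negLog (hr1 _)]
  congr 1
  have e1 : ∀ x, 1 - r x = ∫⁻ m, (1 - ρ (weight α ell m / ‖x‖ ^ 2)) ∂(markLaw c₁ c₂ ν) := by
    intro x
    have hc : Measurable fun m => ρ (weight α ell m / ‖x‖ ^ 2) :=
      hρm.comp (hdiv.comp measurable_prodMk_left)
    rw [lintegral_sub hc
      (ne_top_of_le_ne_top ENNReal.one_ne_top (hr1 x)) (ae_of_all _ fun _ => hρ1 _)]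
    simp [hr]
  simp_rw [e1]
  rw [lintegral_lintegral_swap (f := fun x m => 1 - ρ (weight α ell m / ‖x‖ ^ 2))
    (by exact (measurable_const.sub (hρm.comp hdiv)).aemeasurable)]
  -- For a fixed mark the planar integral depends on the mark only through the factor `π * weight`;
  -- averaging it over the mark law produces `π ω`.
  have e2 : ∀ m, ∫⁻ x : Plane, (1 - ρ (weight α ell m / ‖x‖ ^ 2)) =
      ENNReal.ofReal (Real.pi * weight α ell m) * ∫⁻ s in Ioi (0 : ℝ), (1 - ρ (1 / s)) :=
    fun m => lintegral_comp_div_norm_sq (F := fun W => 1 - ρ W) (weight_nonneg hell.1 m)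
      (measurable_const.sub hρm) (by simp [hρ0])
  simp_rw [e2]
  rw [lintegral_mul_const _ (by fun_prop)]
  simp_rw [ENNReal.ofReal_mul Real.pi_pos.le]
  rw [lintegral_const_mul _ (by fun_prop), lintegral_weight_markLaw hell hc₂, ← mul_assoc,
    mul_assoc Real.pi, ENNReal.ofReal_mul Real.pi_pos.le, ENNReal.ofReal_mul hlam.le]
  ring

end Network

/-! ### The integrals behind `IG` -/

lemma lintegral_exp_neg_mul_Ioi {b : ℝ} (hb : 0 < b) :
    ∫⁻ y in Ioi (0 : ℝ), ENNReal.ofReal (Real.exp (-(b * y))) = ENNReal.ofReal (1 / b) := by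
  have hi : IntegrableOn (fun y => Real.exp (-b * y)) (Ioi 0) := exp_neg_integrableOn_Ioi 0 hb
  have h1 := integral_exp_mul_Ioi (neg_lt_zero.2 hb) 0
  simp_rw [← neg_mul]
  rw [← ofReal_integral_eq_lintegral_ofReal hi (ae_of_all _ fun y => (Real.exp_pos _).le), h1]
  congr 1
  simp

/-- Write `1 / (1 + r^p)` as `∫ exp (-(1 + r^p) y) dy` and exchange the integrals. The inner one is
`Γ(1/p + 1) y^{-1/p} e^{-y}`, the outer one then gives `Γ(1 - 1/p)`, and Euler's reflection formula
concludes. -/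
lemma lintegral_one_div_one_add_rpow {p : ℝ} (hp : 1 < p) :
    ∫⁻ r in Ioi (0 : ℝ), ENNReal.ofReal (1 / (1 + r ^ p)) =
      ENNReal.ofReal (Real.pi * (1 / p) / Real.sin (Real.pi * (1 / p))) := by
  have hp0 : 0 < p := by linarith
  have hip : 1 / p < 1 := by rw [div_lt_one hp0]; exact hp
  have hip0 : 0 < 1 / p := by positivity
  have e1 : ∫⁻ r in Ioi (0 : ℝ), ENNReal.ofReal (1 / (1 + r ^ p)) =
      ∫⁻ r in Ioi (0 : ℝ), ∫⁻ y in Ioi (0 : ℝ), ENNReal.ofReal (Real.exp (-((1 + r ^ p) * y))) := by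
    refine setLIntegral_congr_fun measurableSet_Ioi fun r hr => ?_
    exact (lintegral_exp_neg_mul_Ioi (by have := Real.rpow_nonneg (le_of_lt hr) p; linarith)).symm
  have e2 : ∀ y ∈ Ioi (0 : ℝ), ∫⁻ r in Ioi (0 : ℝ), ENNReal.ofReal (Real.exp (-((1 + r ^ p) * y))) =
      ENNReal.ofReal (Real.exp (-y) * y ^ ((1 - 1 / p) - 1) * Real.Gamma (1 / p + 1)) := by
    intro y hy
    have hi := integrableOn_rpow_mul_exp_neg_mul_rpow (s := 0) (by norm_num) hp0 hy
    simp only [Real.rpow_zero, one_mul] at hi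
    have h1 := integral_exp_neg_mul_rpow hp0 hy
    have : ∀ r : ℝ, ENNReal.ofReal (Real.exp (-((1 + r ^ p) * y))) =
        ENNReal.ofReal (Real.exp (-y)) * ENNReal.ofReal (Real.exp (-y * r ^ p)) := by
      intro r
      rw [← ENNReal.ofReal_mul (Real.exp_pos _).le, ← Real.exp_add]
      congr 2; ring
    simp_rw [this]
    rw [lintegral_const_mul _ (by fun_prop),
      ← ofReal_integral_eq_lintegral_ofReal hi (ae_of_all _ fun y => (Real.exp_pos _).le), h1,
      ← ENNReal.ofReal_mul (Real.exp_pos _).le, mul_assoc]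
    congr 4
    ring
  have hG := Real.GammaIntegral_convergent (s := 1 - 1 / p) (by linarith)
  rw [e1, lintegral_lintegral_swap (by
      exact Measurable.aemeasurable (by fun_prop)), setLIntegral_congr_fun measurableSet_Ioi e2,
    ← ofReal_integral_eq_lintegral_ofReal (hG.mul_const _)]
  · rw [integral_mul_const, ← Real.Gamma_eq_integral (by linarith), Real.Gamma_add_one hip0.ne']
    congr 1
    rw [mul_comm, mul_assoc, Real.Gamma_mul_Gamma_one_sub]
    ring
  · refine (ae_restrict_iff' measurableSet_Ioi).2 (ae_of_all _ fun y hy => ?_)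
    have : 0 < y := hy
    have := Real.Gamma_pos_of_pos (by linarith : 0 < 1 / p + 1)
    positivity

lemma integrableOn_one_div_one_add_rpow {p : ℝ} (hp : 1 < p) :
    IntegrableOn (fun r : ℝ => 1 / (1 + r ^ p)) (Ioi 0) := by
  refine ⟨Measurable.aestronglyMeasurable (by fun_prop), ?_⟩
  rw [hasFiniteIntegral_iff_ofReal, lintegral_one_div_one_add_rpow hp]
  · exact ENNReal.ofReal_lt_top
  · refine (ae_restrict_iff' measurableSet_Ioi).2 (ae_of_all _ fun y hy => ?_)
    have : 0 < y := hy
    change (0 : ℝ) ≤ _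
    positivity

lemma integral_one_div_one_add_rpow {p : ℝ} (hp : 1 < p) :
    ∫ r in Ioi (0 : ℝ), 1 / (1 + r ^ p) =
      Real.pi * (1 / p) / Real.sin (Real.pi * (1 / p)) := by
  have hp0 : 0 < p := by linarith
  have hip : 1 / p < 1 := by rw [div_lt_one hp0]; exact hp
  have hip0 : 0 < 1 / p := by positivity
  rw [integral_eq_lintegral_of_nonneg_ae, lintegral_one_div_one_add_rpow hp, ENNReal.toReal_ofReal]
  · have := Real.sin_pos_of_pos_of_lt_pi (x := Real.pi * (1 / p)) (by positivity)
      (by nlinarith [Real.pi_pos])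
    positivity
  · refine (ae_restrict_iff' measurableSet_Ioi).2 (ae_of_all _ fun y hy => ?_)
    have : 0 < y := hy
    change (0 : ℝ) ≤ _
    positivity
  · exact Measurable.aestronglyMeasurable (by fun_prop)

/-- The sine term of `IG` is the integral over the whole half-line, so subtracting the initial piece
leaves a tail; in this form nonnegativity is visible. -/
lemma IG_eq_integral {u p : ℝ} (hu : 0 < u) (hp : 1 < p) :
    IG u (1 / p) = u ^ (1 / p) * ∫ r in Ioi (u ^ (-(1 / p))), 1 / (1 + r ^ p) := by
  have hq : 0 ≤ u ^ (-(1 / p)) := Real.rpow_nonneg hu.le _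
  have hi := integrableOn_one_div_one_add_rpow hp
  rw [IG, ← integral_one_div_one_add_rpow hp, one_div_one_div,
    intervalIntegral.integral_of_le hq, ← Ioc_union_Ioi_eq_Ioi hq,
    setIntegral_union (Ioc_disjoint_Ioi le_rfl) measurableSet_Ioi
      (hi.mono_set Ioc_subset_Ioi_self) (hi.mono_set (Ioi_subset_Ioi hq))]
  ring

lemma IG_nonneg {u p : ℝ} (hu : 0 < u) (hp : 1 < p) : 0 ≤ IG u (1 / p) := by
  have hq : 0 ≤ u ^ (-(1 / p)) := Real.rpow_nonneg hu.le _
  rw [IG_eq_integral hu hp]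
  refine mul_nonneg (Real.rpow_nonneg hu.le _) (setIntegral_nonneg measurableSet_Ioi fun r hr => ?_)
  have : 0 < r := hq.trans_lt hr
  positivity

/-- The substitution `s = k r` with `k = d u^{1/p}` turns the integrand into `1 / (1 + r^p)` and the
endpoint `d` into `u^{-1/p}`. In the application this is the exponent contributed by all interferers
beyond the serving point `d`. -/
lemma lintegral_interference {u p d : ℝ} (hu : 0 < u) (hp : 1 < p) (hd : 0 < d) :
    ∫⁻ s in Ioi d, ENNReal.ofReal (1 - 1 / (1 + u * (d / s) ^ p)) =
      ENNReal.ofReal (d * IG u (1 / p)) := by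
  have hp0 : 0 < p := by linarith
  have hup : 0 < u ^ (1 / p) := Real.rpow_pos_of_pos hu _
  have hq : 0 < u ^ (-(1 / p)) := Real.rpow_pos_of_pos hu _
  set k := d * u ^ (1 / p) with hk
  have hk0 : 0 < k := by positivity
  set f : ℝ → ℝ := fun s => 1 - 1 / (1 + u * (d / s) ^ p) with hf
  have hkq : k * u ^ (-(1 / p)) = d := by
    rw [hk, mul_assoc, ← Real.rpow_add hu]; simp
  have hfk : ∀ r ∈ Ioi (u ^ (-(1 / p))), f (k * r) = 1 / (1 + r ^ p) := by
    intro r hr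
    have hr0 : 0 < r := hq.trans hr
    have hrp : 0 < r ^ p := Real.rpow_pos_of_pos hr0 p
    have : u * (d / (k * r)) ^ p = 1 / r ^ p := by
      have : d / (k * r) = u ^ (-(1 / p)) / r := by
        rw [hk, Real.rpow_neg hu.le]; field_simp
      rw [this, Real.div_rpow hq.le hr0.le, ← Real.rpow_mul hu.le]
      have : -(1 / p) * p = -1 := by field_simp
      rw [this, Real.rpow_neg_one]
      field_simp
    simp only [hf]
    rw [this]
    field_simp
    ring
  have hi : IntegrableOn (fun r : ℝ => 1 / (1 + r ^ p)) (Ioi (u ^ (-(1 / p)))) :=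
    (integrableOn_one_div_one_add_rpow hp).mono_set (Ioi_subset_Ioi hq.le)
  have hfi : IntegrableOn f (Ioi d) := by
    have := (integrableOn_Ioi_comp_mul_left_iff f (u ^ (-(1 / p))) hk0).1
      (hi.congr_fun (fun r hr => (hfk r hr).symm) measurableSet_Ioi)
    rwa [hkq] at this
  have h1 := integral_comp_mul_left_Ioi f (u ^ (-(1 / p))) hk0
  rw [hkq, setIntegral_congr_fun measurableSet_Ioi hfk] at h1
  rw [← ofReal_integral_eq_lintegral_ofReal hfi, IG_eq_integral hu hp, h1]
  · congr 1
    rw [smul_eq_mul, ← mul_assoc, ← hk, mul_inv_cancel_left₀ hk0.ne']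
  · refine (ae_restrict_iff' measurableSet_Ioi).2 (ae_of_all _ fun s hs => ?_)
    have hs0 : 0 < s := hd.trans hs
    have : 0 ≤ u * (d / s) ^ p := by positivity
    change (0 : ℝ) ≤ 1 - 1 / (1 + u * (d / s) ^ p)
    rw [sub_nonneg, div_le_one (by linarith)]
    linarith

lemma lintegral_expNeg_expMeasure_one {b : ℝ} (hb : 0 ≤ b) :
    ∫⁻ g, expNeg (ENNReal.ofReal (b * g)) ∂(expMeasure 1) = ENNReal.ofReal (1 / (1 + b)) := by
  have hm : Measurable (gammaPDF 1 1) := (measurable_gammaPDFReal 1 1).ennreal_ofReal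
  rw [expMeasure, gammaMeasure, lintegral_withDensity_eq_lintegral_mul _ hm (by fun_prop),
    ← lintegral_exp_neg_mul_Ioi (by linarith : 0 < 1 + b), ← lintegral_indicator measurableSet_Ioi]
  refine lintegral_congr_ae ?_
  filter_upwards [Measure.ae_ne volume (0 : ℝ)] with g hg
  rcases lt_or_gt_of_ne hg with h | h
  · rw [indicator_of_notMem (by simp [h.le]), Pi.mul_apply, gammaPDF_of_neg h, zero_mul]
  · rw [indicator_of_mem (by exact h), Pi.mul_apply, gammaPDF_of_nonneg h.le,
      expNeg_ofReal (by positivity), ← ENNReal.ofReal_mul (by simp; positivity)]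
    congr 1
    simp [← Real.exp_add]
    ring

/-! ### Void probabilities, local finiteness and absence of ties -/

/-- Gains `W i` whose inverses form a Poisson process of rate `c` on the half-line, with
independent `Exp(1)` marks `G i`, as expressed by the Laplace functional. -/
structure IsPoissonGain {Ω : Type*} [MeasurableSpace Ω] (μ : Measure Ω) (W G : ℕ → Ω → ℝ)
    (c : ℝ) : Prop where
  measurable_W : ∀ i, Measurable (W i)
  measurable_G : ∀ i, Measurable (G i)
  nonneg : ∀ i ω, 0 ≤ W i ω
  laplace : ∀ F : ℝ × ℝ → ℝ≥0∞, Measurable F → (∀ g, F (0, g) = 0) →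
    ∫⁻ ω, expNeg (∑' i, F (W i ω, G i ω)) ∂μ =
      expNeg (ENNReal.ofReal c *
        ∫⁻ s in Ioi (0 : ℝ), (1 - ∫⁻ g, expNeg (F (1 / s, g)) ∂(expMeasure 1)))

namespace IsPoissonGain

lemma one_le_mul_one_div_iff {b s : ℝ} (hs : 0 < s) : 1 ≤ b * (1 / s) ↔ s ≤ b := by
  rw [mul_one_div, one_le_div hs]

lemma mul_one_div_lt_one_iff {b s : ℝ} (hs : 0 < s) : b * (1 / s) < 1 ↔ b < s := by
  rw [mul_one_div, div_lt_one hs]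

/-- An infinite weight turns the exponential into an indicator, which is how void events are read
off from the Laplace functional. -/
lemma expNeg_tsum_indicator_top (W : ℕ → ℝ) (b : ℝ) :
    expNeg (∑' i, {w : ℝ | 1 ≤ b * w}.indicator (fun _ => ∞) (W i)) =
      {W : ℕ → ℝ | ∀ i, b * W i < 1}.indicator (fun _ => 1) W := by
  by_cases hW : ∀ i, b * W i < 1
  · rw [indicator_of_mem (by exact hW)]
    have : ∀ i, {w : ℝ | 1 ≤ b * w}.indicator (fun _ => ∞) (W i) = 0 := fun i =>
      indicator_of_notMem (by simpa using hW i) _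
    simp [this]
  · rw [indicator_of_notMem (by exact hW)]
    push Not at hW
    obtain ⟨i, hi⟩ := hW
    have : ∑' i, {w : ℝ | 1 ≤ b * w}.indicator (fun _ => ∞) (W i) = ∞ :=
      ENNReal.tsum_eq_top_of_eq_top ⟨i, indicator_of_mem (by exact hi) _⟩
    rw [this, expNeg_top]

variable {Ω : Type*} [MeasurableSpace Ω] {μ : Measure Ω} {W G : ℕ → Ω → ℝ} {c : ℝ}

lemma measurableSet_void (h : IsPoissonGain μ W G c) (b : ℝ) :
    MeasurableSet {ω | ∀ i, b * W i ω < 1} := by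
  have : {ω | ∀ i, b * W i ω < 1} = ⋂ i, {ω | b * W i ω < 1} := by ext; simp
  rw [this]
  exact MeasurableSet.iInter fun i =>
    measurableSet_lt ((h.measurable_W i).const_mul b) measurable_const

/-- Under `s = 1 / w` the set `S` of gains becomes the interval `(a, b]`, so the number of gains in
`S` has the Laplace transform of a Poisson variable of mean `c (b - a)`. Both finite `p` and `p = ∞`
are used. -/
lemma laplace_indicator (h : IsPoissonGain μ W G c) {S : Set ℝ} (hS : MeasurableSet S)
    (hS0 : (0 : ℝ) ∉ S) {a b : ℝ} (ha : 0 ≤ a)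
    (hab : ∀ s, 0 < s → (1 / s ∈ S ↔ a < s ∧ s ≤ b)) (p : ℝ≥0∞) :
    ∫⁻ ω, expNeg (∑' i, S.indicator (fun _ => p) (W i ω)) ∂μ =
      expNeg (ENNReal.ofReal c * (ENNReal.ofReal (b - a) * (1 - expNeg p))) := by
  have hexp : IsProbabilityMeasure (expMeasure 1) := isProbabilityMeasure_expMeasure one_pos
  have hm : Measurable (S.indicator (fun _ => p)) := measurable_const.indicator hS
  have := h.laplace (fun q => S.indicator (fun _ => p) q.1) (hm.comp measurable_fst)
    (fun g => indicator_of_notMem hS0 _)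
  rw [this]
  congr 2
  simp only [lintegral_const, measure_univ, mul_one]
  have e : ∀ s ∈ Ioi (0 : ℝ), 1 - expNeg (S.indicator (fun _ => p) (1 / s)) =
      (Ioc a b).indicator (fun _ => 1 - expNeg p) s := by
    intro s hs
    by_cases hs' : 1 / s ∈ S
    · rw [indicator_of_mem hs', indicator_of_mem (by exact (hab s hs).1 hs')]
    · rw [indicator_of_notMem hs', indicator_of_notMem (fun h' : s ∈ Ioc a b => hs' ((hab s hs).2 h'))]
      simp
  rw [setLIntegral_congr_fun measurableSet_Ioi e, lintegral_indicator measurableSet_Ioc,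
    Measure.restrict_restrict measurableSet_Ioc, inter_eq_left.2, lintegral_const,
    Measure.restrict_apply_univ, Real.volume_Ioc, mul_comm]
  exact fun s hs => ha.trans_lt hs.1

lemma measure_void (h : IsPoissonGain μ W G c) (hc : 0 ≤ c) {b : ℝ} (hb : 0 ≤ b) :
    μ {ω | ∀ i, b * W i ω < 1} = ENNReal.ofReal (Real.exp (-(c * b))) := by
  have h1 := h.laplace_indicator (S := {w : ℝ | 1 ≤ b * w})
    (measurableSet_le measurable_const (by fun_prop)) (by simp) le_rfl (b := b)
    (fun s hs => by
      rw [mem_ofPred_eq, one_le_mul_one_div_iff hs]; exact ⟨fun h => ⟨hs, h⟩, fun h => h.2⟩) ∞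
  have h2 : ∀ ω, expNeg (∑' i, {w : ℝ | 1 ≤ b * w}.indicator (fun _ => ∞) (W i ω)) =
      {ω | ∀ i, b * W i ω < 1}.indicator (fun _ => 1) ω :=
    fun ω => expNeg_tsum_indicator_top (fun i => W i ω) b
  simp_rw [h2] at h1
  rw [lintegral_indicator (h.measurableSet_void b), setLIntegral_one] at h1
  rw [h1, expNeg_top, sub_zero, tsub_zero, mul_one, ← ENNReal.ofReal_mul hc,
    expNeg_ofReal (mul_nonneg hc hb)]

/-- If every gain vanishes, then every interval `(0, n]` is void, an event of probability `exp (-c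
n)`, which tends to `0`. -/
lemma ae_exists_pos (h : IsPoissonGain μ W G c) (hc : 0 < c) : ∀ᵐ ω ∂μ, ∃ i, 0 < W i ω := by
  rw [ae_iff]
  have hlim : Tendsto (fun n : ℕ => ENNReal.ofReal (Real.exp (-(c * n)))) atTop (𝓝 0) := by
    rw [← ENNReal.ofReal_zero]
    refine (ENNReal.continuous_ofReal.tendsto 0).comp ?_
    exact Real.tendsto_exp_neg_atTop_nhds_zero.comp
      (tendsto_natCast_atTop_atTop.const_mul_atTop hc)
  refine le_antisymm (ge_of_tendsto' hlim fun n => ?_) zero_le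
  rw [← h.measure_void hc.le n.cast_nonneg]
  refine measure_mono fun ω hω i => ?_
  have : ¬ 0 < W i ω := fun h' => hω ⟨i, h'⟩
  have : W i ω = 0 := le_antisymm (not_lt.1 this) (h.nonneg i ω)
  simp [this]

variable [IsProbabilityMeasure μ]

/-- If `K` is the number of such indices, then `𝔼 exp (-ε K) ≤ ℙ(K < ∞)` for each `ε > 0`, and the
explicit left side tends to `1` as `ε → 0`. -/
lemma ae_finite (h : IsPoissonGain μ W G c) (b : ℝ) :
    ∀ᵐ ω ∂μ, {i | 1 ≤ b * W i ω}.Finite := by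
  set S := {w : ℝ | 1 ≤ b * w} with hSdef
  have hS : MeasurableSet S := measurableSet_le measurable_const (by fun_prop)
  set K : Ω → ℝ≥0∞ := fun ω => ∑' i, S.indicator (fun _ => 1) (W i ω) with hK
  have hKm : Measurable K := Measurable.tsum fun i =>
    (measurable_const.indicator hS).comp (h.measurable_W i)
  have hfin : ∀ ω, K ω ≠ ∞ → {i | 1 ≤ b * W i ω}.Finite := by
    intro ω hω
    have : K ω = ({i | 1 ≤ b * W i ω}.encard : ℝ≥0∞) := by
      rw [← ENNReal.tsum_set_one, tsum_subtype {i | 1 ≤ b * W i ω} (fun _ => (1 : ℝ≥0∞))]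
      rfl
    rw [this] at hω
    rw [← encard_ne_top_iff]
    exact fun h' => hω (by rw [h']; simp)
  have hle : ∀ n : ℕ, expNeg (ENNReal.ofReal c * (ENNReal.ofReal b *
      (1 - expNeg (ENNReal.ofReal (1 / ((n : ℝ) + 1)))))) ≤ μ {ω | K ω ≠ ∞} := by
    intro n
    have h1 := h.laplace_indicator hS (by simp [hSdef]) le_rfl (b := b)
      (fun s hs => by
        rw [hSdef, mem_ofPred_eq, one_le_mul_one_div_iff hs]
        exact ⟨fun h => ⟨hs, h⟩, fun h => h.2⟩) (ENNReal.ofReal (1 / ((n : ℝ) + 1)))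
    rw [sub_zero] at h1
    have hms : MeasurableSet {ω | K ω ≠ ∞} := (hKm (measurableSet_singleton ∞)).compl
    rw [← h1, ← setLIntegral_one {ω | K ω ≠ ∞}, ← lintegral_indicator hms]
    refine lintegral_mono fun ω => ?_
    by_cases hω : K ω = ∞
    · have : ∑' i, S.indicator (fun _ => ENNReal.ofReal (1 / ((n : ℝ) + 1))) (W i ω) = ∞ := by
        have e : ∀ i, S.indicator (fun _ => ENNReal.ofReal (1 / ((n : ℝ) + 1))) (W i ω) =
            ENNReal.ofReal (1 / ((n : ℝ) + 1)) * S.indicator (fun _ => 1) (W i ω) := by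
          intro i
          by_cases hi : W i ω ∈ S <;> simp [hi]
        simp_rw [e]
        rw [ENNReal.tsum_mul_left]
        change _ * K ω = ∞
        rw [hω, ENNReal.mul_top]
        exact (ENNReal.ofReal_pos.2 (by positivity)).ne'
      rw [this]; simp
    · rw [indicator_of_mem (by exact hω)]
      exact expNeg_le_one _
  have hlim : Tendsto (fun n : ℕ => expNeg (ENNReal.ofReal c * (ENNReal.ofReal b *
      (1 - expNeg (ENNReal.ofReal (1 / ((n : ℝ) + 1))))))) atTop (𝓝 1) := by
    have h0 : Tendsto (fun n : ℕ => ENNReal.ofReal (1 / ((n : ℝ) + 1))) atTop (𝓝 0) := by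
      rw [← ENNReal.ofReal_zero]
      exact (ENNReal.continuous_ofReal.tendsto 0).comp tendsto_one_div_add_atTop_nhds_zero_nat
    have h1 := (continuous_expNeg.tendsto 0).comp h0
    have h2 := ENNReal.Tendsto.sub (tendsto_const_nhds (x := (1 : ℝ≥0∞))) h1 (Or.inl (by simp))
    have h3 := ENNReal.Tendsto.const_mul (a := ENNReal.ofReal c)
      (ENNReal.Tendsto.const_mul (a := ENNReal.ofReal b) h2 (Or.inr (by simp))) (Or.inr (by simp))
    have h4 := (continuous_expNeg.tendsto _).comp h3
    simpa [Function.comp_def] using h4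
  have h1 : μ {ω | K ω ≠ ∞} = 1 := le_antisymm prob_le_one (le_of_tendsto' hlim hle)
  have h2 : ∀ᵐ ω ∂μ, K ω ≠ ∞ := by
    rw [ae_iff]
    have : {ω | ¬ K ω ≠ ∞} = {ω | K ω ≠ ∞}ᶜ := rfl
    have hms : MeasurableSet {ω | K ω ≠ ∞} := (hKm (measurableSet_singleton ∞)).compl
    rw [this, prob_compl_eq_one_sub hms, h1, tsub_self]
  filter_upwards [h2] with ω hω using hfin ω hω

/-- With `K` the number of points `1 / W i` in `(a, b]`, the bound comes from the transforms at `log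
2` and at `∞`, that is from `𝔼 2^{-K}` and `ℙ(K = 0)`. Its quadratic size in `b - a` is what
excludes ties. -/
lemma measure_pair_le (h : IsPoissonGain μ W G c) (hc : 0 ≤ c) {a b : ℝ} (ha : 0 ≤ a)
    (hab : a ≤ b) :
    μ {ω | ∃ i j, i ≠ j ∧ (1 ≤ b * W i ω ∧ a * W i ω < 1) ∧ (1 ≤ b * W j ω ∧ a * W j ω < 1)} ≤
      ENNReal.ofReal ((c * (b - a)) ^ 2 / 2) := by
  set S := {w : ℝ | 1 ≤ b * w ∧ a * w < 1} with hSdef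
  have hS : MeasurableSet S :=
    (measurableSet_le (measurable_const (a := (1 : ℝ))) (measurable_id.const_mul b)).inter
      (measurableSet_lt (measurable_id.const_mul a) measurable_const)
  set A := {ω | ∃ i j, i ≠ j ∧ W i ω ∈ S ∧ W j ω ∈ S}
  change μ A ≤ _
  set x := c * (b - a) with hx
  have hx0 : 0 ≤ x := mul_nonneg hc (sub_nonneg.2 hab)
  have hWS : ∀ i, MeasurableSet {ω | W i ω ∈ S} := fun i => h.measurable_W i hS
  have hA : MeasurableSet A := by
    have : A = ⋃ i, ⋃ j, {ω | i ≠ j ∧ W i ω ∈ S ∧ W j ω ∈ S} := by ext; simp [A]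
    rw [this]
    refine MeasurableSet.iUnion fun i => MeasurableSet.iUnion fun j => ?_
    exact (MeasurableSet.const _).inter ((hWS i).inter (hWS j))
  have hlap := h.laplace_indicator hS (by simp [hSdef]) ha (b := b)
    (fun s hs => by
      rw [hSdef, mem_ofPred_eq, one_le_mul_one_div_iff hs, mul_one_div_lt_one_iff hs, and_comm])
  have hval : ∀ y : ℝ, 0 ≤ y → y ≤ 1 → expNeg (ENNReal.ofReal c * (ENNReal.ofReal (b - a) *
      (1 - ENNReal.ofReal y))) = ENNReal.ofReal (Real.exp (-(x * (1 - y)))) := by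
    intro y hy0 hy1
    rw [← ENNReal.ofReal_one, ← ENNReal.ofReal_sub _ hy0,
      ← ENNReal.ofReal_mul (sub_nonneg.2 hab), ← ENNReal.ofReal_mul hc,
      expNeg_ofReal (mul_nonneg hc (mul_nonneg (sub_nonneg.2 hab) (sub_nonneg.2 hy1))), hx,
      mul_assoc]
  have hp : expNeg (ENNReal.ofReal (Real.log 2)) = ENNReal.ofReal (1 / 2) := by
    rw [expNeg_ofReal (Real.log_nonneg (by norm_num)), Real.exp_neg, Real.exp_log (by norm_num)]
    simp
  have hhalf := hlap (ENNReal.ofReal (Real.log 2))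
  rw [hp, hval _ (by norm_num) (by norm_num)] at hhalf
  have hzero := hlap ∞
  rw [expNeg_top, ← ENNReal.ofReal_zero, hval 0 le_rfl zero_le_one] at hzero
  set f : Ω → ℝ≥0∞ := fun ω =>
    expNeg (∑' i, S.indicator (fun _ => ENNReal.ofReal (Real.log 2)) (W i ω)) with hf
  set f0 : Ω → ℝ≥0∞ := fun ω => expNeg (∑' i, S.indicator (fun _ => ∞) (W i ω)) with hf0
  have hfm : Measurable f := measurable_expNeg.comp (Measurable.tsum fun i =>
    (measurable_const.indicator hS).comp (h.measurable_W i))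
  have hf0m : Measurable f0 := measurable_expNeg.comp (Measurable.tsum fun i =>
    (measurable_const.indicator hS).comp (h.measurable_W i))
  -- In terms of `K`: `2^{-K} + (1/4) 1{K ≥ 2} ≤ 1/2 + (1/2) 1{K = 0}`, with equality for `K = 0, 1,
  -- 2`.
  have hpt : ∀ ω, f ω + ENNReal.ofReal (1 / 4) * A.indicator (fun _ => 1) ω ≤
      ENNReal.ofReal (1 / 2) + ENNReal.ofReal (1 / 2) * f0 ω := by
    intro ω
    by_cases hω : ω ∈ A
    · rw [indicator_of_mem hω, mul_one]
      obtain ⟨i, j, hij, hi, hj⟩ := hω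
      have h1 : f ω ≤ ENNReal.ofReal (1 / 4) := by
        have : ENNReal.ofReal (1 / 4) =
            expNeg (ENNReal.ofReal (Real.log 2) + ENNReal.ofReal (Real.log 2)) := by
          rw [expNeg_add, hp, ← ENNReal.ofReal_mul (by norm_num)]; norm_num
        rw [this]
        refine antitone_expNeg ?_
        refine le_trans ?_ (ENNReal.sum_le_tsum {i, j})
        rw [Finset.sum_pair hij, indicator_of_mem hi, indicator_of_mem hj]
      calc _ ≤ ENNReal.ofReal (1 / 4) + ENNReal.ofReal (1 / 4) := by gcongr
        _ = ENNReal.ofReal (1 / 2) := by rw [← ENNReal.ofReal_add] <;> norm_num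
        _ ≤ _ := le_self_add
    · rw [indicator_of_notMem hω, mul_zero, add_zero]
      by_cases hex : ∃ i, W i ω ∈ S
      · obtain ⟨i, hi⟩ := hex
        refine le_trans ?_ le_self_add
        rw [← hp]
        refine antitone_expNeg ?_
        refine le_trans ?_ (ENNReal.le_tsum i)
        rw [indicator_of_mem hi]
      · have : f0 ω = 1 := by
          have : ∀ i, S.indicator (fun _ => ∞) (W i ω) = 0 := fun i =>
            indicator_of_notMem (fun hi => hex ⟨i, hi⟩) _
          simp [hf0, this]
        rw [this, mul_one, ← ENNReal.ofReal_add (by norm_num) (by norm_num)]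
        refine (expNeg_le_one _).trans_eq ?_
        norm_num
  have hint := lintegral_mono (μ := μ) hpt
  rw [lintegral_add_left hfm, lintegral_const_mul _ (measurable_const.indicator hA),
    lintegral_indicator hA, setLIntegral_one, lintegral_add_left measurable_const,
    lintegral_const_mul _ hf0m, lintegral_const, measure_univ, mul_one, hhalf, hzero,
    ← ofReal_measureReal (μ := μ) (s := A), ← ENNReal.ofReal_mul (by norm_num),
    ← ENNReal.ofReal_mul (by norm_num),
    ← ENNReal.ofReal_add (by positivity) (by positivity),
    ← ENNReal.ofReal_add (by positivity) (by positivity),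
    ENNReal.ofReal_le_ofReal_iff (by positivity)] at hint
  rw [← ofReal_measureReal (μ := μ) (s := A)]
  refine ENNReal.ofReal_le_ofReal ?_
  -- With `q = exp (-x/2)` the integrated inequality reads `ℙ(A) ≤ 2 (1 - q)²`, and `0 ≤ 1 - q ≤
  -- x/2`.
  have e1 : Real.exp (-(x * (1 - 0))) = Real.exp (-(x * (1 - 1 / 2))) ^ 2 := by
    rw [← Real.exp_nat_mul]; congr 1; push_cast; ring
  rw [e1] at hint
  have e2 : 1 - x / 2 ≤ Real.exp (-(x * (1 - 1 / 2))) := by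
    have := Real.add_one_le_exp (-(x * (1 - 1 / 2))); linarith
  have e3 : Real.exp (-(x * (1 - 1 / 2))) ≤ 1 := Real.exp_le_one_iff.2 (by linarith)
  nlinarith

/-- Cut `(0, M]` into `n + 1` cells of equal width `δ`. A tie puts two points in one cell, so its
probability is at most `(n + 1) (c δ)² / 2`, which is of order `1 / (n + 1)`. Zero gains are
excluded: they correspond to no point and may well coincide. -/
lemma ae_injective (h : IsPoissonGain μ W G c) (hc : 0 ≤ c) :
    ∀ᵐ ω ∂μ, ∀ i j, i ≠ j → W i ω = W j ω → W i ω = 0 := by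
  have key : ∀ M : ℕ, μ {ω | ∃ i j, i ≠ j ∧ W i ω = W j ω ∧ 1 ≤ M * W i ω} = 0 := by
    intro M
    have hle : ∀ n : ℕ, μ {ω | ∃ i j, i ≠ j ∧ W i ω = W j ω ∧ 1 ≤ M * W i ω} ≤
        ENNReal.ofReal ((c * M) ^ 2 / 2 * (1 / ((n : ℝ) + 1))) := by
      intro n
      set δ : ℝ := M / ((n : ℝ) + 1) with hδ
      have hδ0 : 0 ≤ δ := by positivity
      calc _ ≤ μ (⋃ k ∈ Finset.range (n + 1), {ω | ∃ i j, i ≠ j ∧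
              (1 ≤ ((k : ℝ) + 1) * δ * W i ω ∧ (k : ℝ) * δ * W i ω < 1) ∧
              (1 ≤ ((k : ℝ) + 1) * δ * W j ω ∧ (k : ℝ) * δ * W j ω < 1)}) := by
            refine measure_mono ?_
            rintro ω ⟨i, j, hij, he, hi⟩
            have hcell : ∃ k < n + 1, 1 ≤ ((k : ℝ) + 1) * δ * W i ω ∧
                (k : ℝ) * δ * W i ω < 1 := by
              by_contra hno
              push Not at hno
              -- If no cell contained `1 / W i`, the point would be pushed past each endpoint in
              -- turn and finally past `M`, against `1 ≤ M * W i`.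
              have : ∀ k ≤ n + 1, (k : ℝ) * δ * W i ω < 1 := by
                intro k
                induction k with
                | zero => intro; simp
                | succ k ih =>
                  intro hk
                  by_contra hlt
                  push_cast at hlt
                  exact absurd (ih (by omega)) (not_lt.2 (hno k (by omega) (not_lt.1 hlt)))
              have h2 := this (n + 1) le_rfl
              have h3 : ((n + 1 : ℕ) : ℝ) * δ = M := by
                rw [hδ]; push_cast; field_simp
              rw [h3] at h2
              linarith
            obtain ⟨k, hk, hk'⟩ := hcell
            simp only [Finset.mem_range, mem_iUnion]
            exact ⟨k, hk, i, j, hij, hk', he ▸ hk'⟩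
        _ ≤ ∑ k ∈ Finset.range (n + 1), ENNReal.ofReal ((c * δ) ^ 2 / 2) := by
            refine (measure_biUnion_finset_le _ _).trans (Finset.sum_le_sum fun k _ => ?_)
            have := h.measure_pair_le hc (a := k * δ) (b := (k + 1) * δ) (by positivity)
              (by nlinarith)
            rwa [show ((k : ℝ) + 1) * δ - k * δ = δ by ring] at this
        _ = _ := by
            rw [Finset.sum_const, Finset.card_range, nsmul_eq_mul, ← ENNReal.ofReal_natCast,
              ← ENNReal.ofReal_mul (by positivity)]
            congr 1
            rw [hδ]; push_cast; field_simp
    have hlim : Tendsto (fun n : ℕ => ENNReal.ofReal ((c * M) ^ 2 / 2 * (1 / ((n : ℝ) + 1))))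
        atTop (𝓝 0) := by
      have := (tendsto_one_div_add_atTop_nhds_zero_nat (𝕜 := ℝ)).const_mul ((c * M) ^ 2 / 2)
      rw [mul_zero] at this
      rw [← ENNReal.ofReal_zero]
      exact (ENNReal.continuous_ofReal.tendsto 0).comp this
    exact le_antisymm (ge_of_tendsto' hlim hle) zero_le
  have hall : ∀ᵐ ω ∂μ, ∀ M : ℕ, ¬ ∃ i j, i ≠ j ∧ W i ω = W j ω ∧ 1 ≤ M * W i ω := by
    rw [ae_all_iff]
    intro M
    rw [ae_iff]
    simpa using key M
  filter_upwards [hall] with ω hω i j hij he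
  by_contra hne
  have hpos : 0 < W i ω := lt_of_le_of_ne (h.nonneg i ω) (Ne.symm hne)
  obtain ⟨M, hM⟩ := exists_nat_gt (1 / W i ω)
  rw [div_lt_iff₀ hpos] at hM
  exact hω M ⟨i, j, hij, he, hM.le⟩

/-- Almost surely there is a unique strongest gain, and it is positive. -/
theorem ae_exists_max (h : IsPoissonGain μ W G c) (hc : 0 < c) :
    ∀ᵐ ω ∂μ, ∃ i, 0 < W i ω ∧ ∀ j, j ≠ i → W j ω < W i ω := by
  have hfin : ∀ᵐ ω ∂μ, ∀ n : ℕ, {i | 1 ≤ (n : ℝ) * W i ω}.Finite :=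
    ae_all_iff.2 fun n => h.ae_finite n
  filter_upwards [h.ae_exists_pos hc, hfin, h.ae_injective hc.le] with ω ⟨i₀, hi₀⟩ hω hinj
  obtain ⟨n, hn⟩ := exists_nat_gt (1 / W i₀ ω)
  have hn' := hn
  rw [div_lt_iff₀ hi₀] at hn'
  obtain ⟨i, hi, hmax⟩ := (hω n).exists_maximalFor (fun i => W i ω) _ ⟨i₀, hn'.le⟩
  have hn0 : (0 : ℝ) < n := lt_trans (by positivity) hn
  have hipos : 0 < W i ω := by
    have : (1 : ℝ) ≤ n * W i ω := hi
    by_contra hneg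
    nlinarith
  have hle : ∀ j, W j ω ≤ W i ω := by
    intro j
    by_contra hlt
    push Not at hlt
    have hj : (1 : ℝ) ≤ n * W j ω := le_trans hi (by gcongr)
    exact absurd (hmax hj hlt.le) (not_le.2 hlt)
  refine ⟨i, hipos, fun j hj => lt_of_le_of_ne (hle j) fun he => ?_⟩
  exact hipos.ne' (hinj i j hj.symm he.symm)

end IsPoissonGain

/-! ### Meshes of the half-line and limits along them -/

lemma ae_pos_expMeasure {c : ℝ} (hc : 0 < c) : ∀ᵐ d ∂(expMeasure c), 0 < d := by
  have hprob := isProbabilityMeasure_expMeasure hc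
  have hz : (expMeasure c).real (Iic 0) = 0 := by
    rw [← cdf_eq_real, cdf_expMeasure_eq hc, if_pos le_rfl]; simp
  rw [ae_iff]
  have : {d : ℝ | ¬ 0 < d} = Iic 0 := by ext; simp
  rw [this]
  exact (measureReal_eq_zero_iff (measure_ne_top _ _)).1 hz

/-- Finite partial sums control the sum from below and the bound `t j ≤ T j` from above, so no
summability is required and the limit may be `∞`. -/
lemma tendsto_tsum_of_le {ι β : Type*} {l : Filter β} {t : ι → β → ℝ≥0∞} {T : ι → ℝ≥0∞}
    (hle : ∀ᶠ x in l, ∀ j, t j x ≤ T j) (ht : ∀ j, Tendsto (t j) l (𝓝 (T j))) :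
    Tendsto (fun x => ∑' j, t j x) l (𝓝 (∑' j, T j)) := by
  refine tendsto_order.2 ⟨fun a ha => ?_, fun a ha => ?_⟩
  · rw [ENNReal.tsum_eq_iSup_sum, lt_iSup_iff] at ha
    obtain ⟨s, hs⟩ := ha
    have h1 : Tendsto (fun x => ∑ j ∈ s, t j x) l (𝓝 (∑ j ∈ s, T j)) :=
      tendsto_finsetSum s fun j _ => ht j
    filter_upwards [h1.eventually (lt_mem_nhds hs)] with x hx
    exact hx.trans_le (ENNReal.sum_le_tsum s)
  · filter_upwards [hle] with x hx
    exact (ENNReal.tsum_le_tsum hx).trans_lt ha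

/-- Pairs `(a, b)` with `0 ≤ a < D ≤ b`. -/
def bracket (D : ℝ) : Set (ℝ × ℝ) := {p | 0 ≤ p.1 ∧ p.1 < D ∧ D ≤ p.2}

/-- The endpoints `k / (n + 1)` of the cells of the mesh of width `1 / (n + 1)`. -/
noncomputable def node (n k : ℕ) : ℝ := (k : ℝ) / ((n : ℝ) + 1)

lemma node_nonneg (n k : ℕ) : 0 ≤ node n k := by unfold node; positivity

lemma node_le_succ (n k : ℕ) : node n k ≤ node n (k + 1) := by
  unfold node; gcongr; simp

lemma exists_node {D : ℝ} (hD : 0 < D) (n : ℕ) : ∃ k, node n k < D ∧ D ≤ node n (k + 1) := by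
  have hn : (0 : ℝ) < n + 1 := by positivity
  have hc : 0 < ⌈D * (n + 1)⌉₊ := Nat.ceil_pos.2 (by positivity)
  -- Cells are open on the left and closed on the right, hence the ceiling minus one; `0 < D` makes
  -- the natural-number subtraction genuine.
  refine ⟨⌈D * (n + 1)⌉₊ - 1, ?_, ?_⟩
  · rw [node, div_lt_iff₀ hn]
    exact Nat.lt_ceil.1 (by omega)
  · rw [node, le_div_iff₀ hn, Nat.sub_add_cancel hc]
    exact Nat.le_ceil _

lemma node_unique {D : ℝ} {n k l : ℕ} (hk : node n k < D ∧ D ≤ node n (k + 1))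
    (hl : node n l < D ∧ D ≤ node n (l + 1)) : k = l := by
  have hn : (0 : ℝ) < n + 1 := by positivity
  have h1 := hk.1.trans_le hl.2
  have h2 := hl.1.trans_le hk.2
  unfold node at h1 h2
  rw [div_lt_div_iff_of_pos_right hn] at h1 h2
  have h1' : k < l + 1 := by exact_mod_cast h1
  have h2' : l < k + 1 := by exact_mod_cast h2
  omega

/-- Exactly one cell of each mesh contains `D`, so the series is `φ` at the two ends of that cell,
and these approach `(D, D)` from within `bracket D`. -/
lemma tendsto_tsum_cells {φ : ℝ × ℝ → ℝ≥0∞} {D : ℝ} (hD : 0 < D) {L : ℝ≥0∞}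
    (h : Tendsto φ (𝓝[bracket D] (D, D)) (𝓝 L)) :
    Tendsto (fun n : ℕ => ∑' k : ℕ, {D' | node n k < D' ∧ D' ≤ node n (k + 1)}.indicator
      (fun _ => φ (node n k, node n (k + 1))) D) atTop (𝓝 L) := by
  choose k hk using exists_node hD
  have hsum : ∀ n, ∑' l : ℕ, {D' | node n l < D' ∧ D' ≤ node n (l + 1)}.indicator
      (fun _ => φ (node n l, node n (l + 1))) D = φ (node n (k n), node n (k n + 1)) := by
    intro n
    rw [tsum_eq_single (k n)]
    · exact indicator_of_mem (s := {D' | node n (k n) < D' ∧ D' ≤ node n (k n + 1)}) (hk n) _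
    · intro l hl
      exact indicator_of_notMem (s := {D' | node n l < D' ∧ D' ≤ node n (l + 1)})
        (fun hl' => hl (node_unique hl' (hk n))) _
  simp_rw [hsum]
  refine h.comp (tendsto_nhdsWithin_iff.2 ⟨?_, Eventually.of_forall fun n =>
    ⟨node_nonneg _ _, (hk n).1, (hk n).2⟩⟩)
  have hw : ∀ n, node n (k n + 1) = node n (k n) + 1 / ((n : ℝ) + 1) := fun n => by
    unfold node; push_cast; ring
  have hz := tendsto_one_div_add_atTop_nhds_zero_nat (𝕜 := ℝ)
  refine Tendsto.prodMk_nhds ?_ ?_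
  · refine tendsto_of_tendsto_of_tendsto_of_le_of_le (g := fun n : ℕ => D - 1 / ((n : ℝ) + 1))
      (h := fun _ => D) ?_ tendsto_const_nhds (fun n => ?_) (fun n => (hk n).1.le)
    · simpa using hz.const_sub D
    · have := (hk n).2; rw [hw] at this; change D - 1 / ((n : ℝ) + 1) ≤ _; linarith
  · refine tendsto_of_tendsto_of_tendsto_of_le_of_le (g := fun _ => D)
      (h := fun n : ℕ => D + 1 / ((n : ℝ) + 1)) tendsto_const_nhds ?_ (fun n => (hk n).2)
      (fun n => ?_)
    · simpa using hz.const_add D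
    · have := (hk n).1; change node n (k n + 1) ≤ D + 1 / ((n : ℝ) + 1); rw [hw]; linarith

/-- The rate functional `∫_b^∞ (1 - 1 / (1 + u (a / s)^p)) ds`. -/
noncomputable def tailRate (u p : ℝ) (q : ℝ × ℝ) : ℝ≥0∞ :=
  ∫⁻ s in Ioi q.2, ENNReal.ofReal (1 - 1 / (1 + u * (q.1 / s) ^ p))

/-- On `bracket D` the left endpoint stays below `D` and the right one does not, so the integrand at
`(D, D)` dominates; its integral is finite by `lintegral_interference`. Pointwise convergence is
needed only off the null point `s = D`. -/
lemma tendsto_tailRate {u p D : ℝ} (hu : 0 < u) (hp : 1 < p) (hD : 0 < D) :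
    Tendsto (tailRate u p) (𝓝[bracket D] (D, D)) (𝓝 (tailRate u p (D, D))) := by
  have hp0 : 0 < p := by linarith
  have hrep : ∀ q, tailRate u p q = ∫⁻ s, (Ioi q.2).indicator
      (fun s => ENNReal.ofReal (1 - 1 / (1 + u * (q.1 / s) ^ p))) s := fun q =>
    (lintegral_indicator measurableSet_Ioi _).symm
  rw [funext hrep]
  refine tendsto_lintegral_filter_of_dominated_convergence (l := 𝓝[bracket D] (D, D))
    (fun s => (Ioi D).indicator (fun s => ENNReal.ofReal (1 - 1 / (1 + u * (D / s) ^ p))) s)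
    (Eventually.of_forall fun q => ?_) ?_ ?_ ?_
  · exact Measurable.indicator (by fun_prop) measurableSet_Ioi
  · filter_upwards [self_mem_nhdsWithin] with q hq
    refine ae_of_all _ fun s => ?_
    by_cases hs : q.2 < s
    · have hDs : D < s := hq.2.2.trans_lt hs
      have hs0 : 0 < s := hD.trans hDs
      rw [indicator_of_mem (by exact hs), indicator_of_mem (by exact hDs)]
      have h1 : q.1 / s ≤ D / s := by gcongr; exact hq.2.1.le
      have h2 : (q.1 / s) ^ p ≤ (D / s) ^ p :=
        Real.rpow_le_rpow (div_nonneg hq.1 hs0.le) h1 hp0.le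
      have h3 : 0 ≤ (q.1 / s) ^ p := Real.rpow_nonneg (div_nonneg hq.1 hs0.le) _
      gcongr
    · rw [indicator_of_notMem (by exact hs)]; exact zero_le
  · rw [lintegral_indicator measurableSet_Ioi, lintegral_interference hu hp hD]
    exact ENNReal.ofReal_ne_top
  · filter_upwards [Measure.ae_ne volume D] with s hs
    rcases lt_or_gt_of_ne hs with h | h
    · rw [indicator_of_notMem (by simp [h.le])]
      refine tendsto_const_nhds.congr' ?_
      filter_upwards [self_mem_nhdsWithin] with q hq
      rw [indicator_of_notMem]
      have : D ≤ q.2 := hq.2.2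
      simp only [mem_Ioi, not_lt]; linarith
    · have hs0 : 0 < s := hD.trans h
      rw [indicator_of_mem (by exact h)]
      have hev : ∀ᶠ q : ℝ × ℝ in 𝓝[bracket D] (D, D), q.2 < s :=
        nhdsWithin_le_nhds ((continuous_snd.tendsto (D, D)).eventually (gt_mem_nhds h))
      have hcont : Tendsto (fun q : ℝ × ℝ => ENNReal.ofReal (1 - 1 / (1 + u * (q.1 / s) ^ p)))
          (𝓝[bracket D] (D, D)) (𝓝 (ENNReal.ofReal (1 - 1 / (1 + u * (D / s) ^ p)))) := by
        have h1 : Tendsto (fun q : ℝ × ℝ => (q.1 / s) ^ p) (𝓝[bracket D] (D, D))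
            (𝓝 ((D / s) ^ p)) :=
          (((continuous_fst.tendsto (D, D)).mono_left nhdsWithin_le_nhds).div_const s).rpow_const
            (Or.inr hp0.le)
        have h2 : 1 + u * (D / s) ^ p ≠ 0 := by positivity
        exact (ENNReal.continuous_ofReal.tendsto _).comp
          (tendsto_const_nhds.sub (tendsto_const_nhds.div
            (tendsto_const_nhds.add (h1.const_mul u)) h2))
      refine hcont.congr' ?_
      filter_upwards [hev] with q hq
      rw [indicator_of_mem (by exact hq)]

/-! ### Laplace transform of the load -/

namespace IsPoissonGain

variable {Ω : Type*}

/-- The noise and interference seen at the scale `a`, from the points beyond `b`. -/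
noncomputable def load (W G : ℕ → Ω → ℝ) (κ p : ℝ) (q : ℝ × ℝ) (ω : Ω) : ℝ≥0∞ :=
  ENNReal.ofReal (κ * q.1 ^ p) +
    ∑' i, if q.2 * W i ω < 1 then ENNReal.ofReal (G i ω * (q.1 * W i ω) ^ p) else 0

/-- The strongest gain. -/
noncomputable def maxGain (W : ℕ → Ω → ℝ) (ω : Ω) : ℝ := (⨆ i, ENNReal.ofReal (W i ω)).toReal

lemma maxGain_eq {W : ℕ → Ω → ℝ} {ω : Ω} {i : ℕ} (hi : 0 ≤ W i ω) (hmax : ∀ j, W j ω ≤ W i ω) :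
    maxGain W ω = W i ω := by
  have : ⨆ j, ENNReal.ofReal (W j ω) = ENNReal.ofReal (W i ω) :=
    le_antisymm (iSup_le fun j => ENNReal.ofReal_le_ofReal (hmax j))
      (le_iSup (fun j => ENNReal.ofReal (W j ω)) i)
  rw [maxGain, this, ENNReal.toReal_ofReal hi]

/-- Within the bracket each term is at most its value at `(D, D)`, since lowering `a` shrinks the
term and raising `b` only discards points. A point with `D W < 1` is eventually kept, and one with
`D W ≥ 1`, in particular the one at distance `D`, is never counted. -/
lemma tendsto_load {W G : ℕ → Ω → ℝ} {ω : Ω} (hW : ∀ i, 0 ≤ W i ω) (hG : ∀ i, 0 ≤ G i ω)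
    {κ p D : ℝ} (hp : 0 < p) :
    Tendsto (fun q => load W G κ p q ω) (𝓝[bracket D] (D, D)) (𝓝 (load W G κ p (D, D) ω)) := by
  have hfst : Tendsto (fun q : ℝ × ℝ => q.1) (𝓝[bracket D] (D, D)) (𝓝 D) :=
    (continuous_fst.tendsto (D, D)).mono_left nhdsWithin_le_nhds
  have hsnd : Tendsto (fun q : ℝ × ℝ => q.2) (𝓝[bracket D] (D, D)) (𝓝 D) :=
    (continuous_snd.tendsto (D, D)).mono_left nhdsWithin_le_nhds
  unfold load
  refine Tendsto.add ?_ (tendsto_tsum_of_le ?_ fun i => ?_)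
  · exact (ENNReal.continuous_ofReal.tendsto _).comp
      ((hfst.rpow_const (Or.inr hp.le)).const_mul κ)
  · filter_upwards [self_mem_nhdsWithin] with q hq i
    have hD0 : 0 ≤ D := hq.1.trans hq.2.1.le
    by_cases hi : q.2 * W i ω < 1
    · have hi' : D * W i ω < 1 := (mul_le_mul_of_nonneg_right hq.2.2 (hW i)).trans_lt hi
      rw [if_pos hi, if_pos hi']
      refine ENNReal.ofReal_le_ofReal (mul_le_mul_of_nonneg_left ?_ (hG i))
      exact Real.rpow_le_rpow (mul_nonneg hq.1 (hW i))
        (mul_le_mul_of_nonneg_right hq.2.1.le (hW i)) hp.le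
    · rw [if_neg hi]; exact zero_le
  · by_cases hi : D * W i ω < 1
    · simp only [if_pos hi]
      have h1 : Tendsto (fun q : ℝ × ℝ => ENNReal.ofReal (G i ω * (q.1 * W i ω) ^ p))
          (𝓝[bracket D] (D, D)) (𝓝 (ENNReal.ofReal (G i ω * (D * W i ω) ^ p))) :=
        (ENNReal.continuous_ofReal.tendsto _).comp
          (((hfst.mul_const _).rpow_const (Or.inr hp.le)).const_mul _)
      refine h1.congr' ?_
      filter_upwards [(hsnd.mul_const (W i ω)).eventually (gt_mem_nhds hi)] with q hq
      rw [if_pos hq]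
    · simp only [if_neg hi]
      refine tendsto_const_nhds.congr' ?_
      filter_upwards [self_mem_nhdsWithin] with q hq
      rw [if_neg]
      exact fun h' => hi ((mul_le_mul_of_nonneg_right hq.2.2 (hW i)).trans_lt h')

variable [MeasurableSpace Ω] {μ : Measure Ω} {W G : ℕ → Ω → ℝ} {c : ℝ}

lemma measurable_load (h : IsPoissonGain μ W G c) (κ p : ℝ) (q : ℝ × ℝ) :
    Measurable (load W G κ p q) := by
  have h3 : Measurable fun ω => ∑' i,
      if q.2 * W i ω < 1 then ENNReal.ofReal (G i ω * (q.1 * W i ω) ^ p) else 0 := by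
    refine Measurable.tsum fun i => ?_
    have h1 := h.measurable_W i
    have h2 := h.measurable_G i
    exact Measurable.ite (measurableSet_lt (h1.const_mul _) measurable_const) (by fun_prop)
      measurable_const
  exact measurable_const.add h3

/-- The scale `a`, the void radius `v` and the inner radius `b` of the interference are kept
separate so that `v = a` and `v = b` can be subtracted with the same integrand. -/
lemma lintegral_void_load (h : IsPoissonGain μ W G c) (hc : 0 ≤ c) {u κ p : ℝ} (hu : 0 < u)
    (hκ : 0 ≤ κ) (hp : 1 < p) {v a b : ℝ} (ha : 0 ≤ a) (hv : 0 ≤ v) (hvb : v ≤ b) :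
    ∫⁻ ω, {ω | ∀ i, v * W i ω < 1}.indicator
      (fun ω => expNeg (ENNReal.ofReal u * load W G κ p (a, b) ω)) ω ∂μ =
      ENNReal.ofReal (Real.exp (-(c * v))) * (ENNReal.ofReal (Real.exp (-(u * (κ * a ^ p)))) *
        expNeg (ENNReal.ofReal c * tailRate u p (a, b))) := by
  have hp0 : 0 < p := by linarith
  have hexp : IsProbabilityMeasure (expMeasure 1) := isProbabilityMeasure_expMeasure one_pos
  -- Points up to `v` get weight `∞`, which forces the void, points beyond `b` get their fading
  -- term, and points in `(v, b]` get nothing. The two nonzero contributions have disjoint supports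
  -- because `v ≤ b`.
  set F : ℝ × ℝ → ℝ≥0∞ := fun z => {w : ℝ | 1 ≤ v * w}.indicator (fun _ => ∞) z.1 +
    if b * z.1 < 1 then ENNReal.ofReal (u * (a * z.1) ^ p * z.2) else 0 with hF
  have hFm : Measurable F := by
    refine Measurable.add ?_ (Measurable.ite (measurableSet_lt (by fun_prop) measurable_const)
      (by fun_prop) measurable_const)
    exact (measurable_const.indicator
      (measurableSet_le measurable_const (by fun_prop))).comp measurable_fst
  have hF0 : ∀ g, F (0, g) = 0 := by
    intro g; simp [hF, Real.zero_rpow hp0.ne']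
  have hpt : ∀ ω, {ω | ∀ i, v * W i ω < 1}.indicator
      (fun ω => expNeg (ENNReal.ofReal u * load W G κ p (a, b) ω)) ω =
      ENNReal.ofReal (Real.exp (-(u * (κ * a ^ p)))) *
        expNeg (∑' i, F (W i ω, G i ω)) := by
    intro ω
    have e1 : ∑' i, F (W i ω, G i ω) =
        ∑' i, {w : ℝ | 1 ≤ v * w}.indicator (fun _ => ∞) (W i ω) +
        ENNReal.ofReal u * ∑' i, if b * W i ω < 1 then
          ENNReal.ofReal (G i ω * (a * W i ω) ^ p) else 0 := by
      rw [← ENNReal.tsum_mul_left, ← ENNReal.tsum_add]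
      refine tsum_congr fun i => ?_
      simp only [hF]
      congr 1
      split_ifs
      · rw [← ENNReal.ofReal_mul hu.le]; congr 1; ring
      · simp
    rw [e1, expNeg_add, expNeg_tsum_indicator_top (fun i => W i ω) v]
    by_cases hω : ∀ i, v * W i ω < 1
    · rw [indicator_of_mem (by exact hω), indicator_of_mem (by exact hω), load, mul_add, expNeg_add,
        ← ENNReal.ofReal_mul hu.le, expNeg_ofReal (by positivity), one_mul]
    · rw [indicator_of_notMem (by exact hω), indicator_of_notMem (by exact hω)]
      simp
  simp_rw [hpt]
  have hFmeas : Measurable fun ω => expNeg (∑' i, F (W i ω, G i ω)) :=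
    measurable_expNeg.comp (Measurable.tsum fun i =>
      hFm.comp ((h.measurable_W i).prodMk (h.measurable_G i)))
  rw [lintegral_const_mul _ hFmeas, h.laplace F hFm hF0]
  have hint : ∫⁻ s in Ioi (0 : ℝ), (1 - ∫⁻ g, expNeg (F (1 / s, g)) ∂(expMeasure 1)) =
      ENNReal.ofReal v + tailRate u p (a, b) := by
    have hval : ∀ s ∈ Ioi (0 : ℝ), 1 - ∫⁻ g, expNeg (F (1 / s, g)) ∂(expMeasure 1) =
        (Ioc 0 v).indicator (fun _ => 1) s + (Ioi b).indicator
          (fun s => ENNReal.ofReal (1 - 1 / (1 + u * (a / s) ^ p))) s := by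
      intro s hs
      have hs0 : 0 < s := hs
      by_cases hsv : s ≤ v
      · have hm : 1 / s ∈ {w : ℝ | 1 ≤ v * w} := (one_le_mul_one_div_iff hs0).2 hsv
        have : ∀ g, F (1 / s, g) = ∞ := by
          intro g; simp only [hF]; rw [indicator_of_mem hm, top_add]
        have hmem : s ∈ Ioc 0 v := ⟨hs, hsv⟩
        have hnot : s ∉ Ioi b := fun h' : b < s => absurd (hsv.trans hvb) (not_le.2 h')
        rw [indicator_of_mem hmem, indicator_of_notMem hnot]
        simp_rw [this]
        simp
      · have hn : 1 / s ∉ {w : ℝ | 1 ≤ v * w} := fun h' =>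
          hsv ((one_le_mul_one_div_iff hs0).1 h')
        have hnot : s ∉ Ioc 0 v := fun h' => hsv h'.2
        rw [indicator_of_notMem hnot, zero_add]
        by_cases hsb : b < s
        · have hsb' : b * (1 / s) < 1 := (mul_one_div_lt_one_iff hs0).2 hsb
          have : ∀ g, F (1 / s, g) = ENNReal.ofReal (u * (a / s) ^ p * g) := by
            intro g; simp only [hF]
            rw [indicator_of_notMem hn, zero_add, if_pos hsb', mul_one_div]
          simp_rw [this]
          have h0 : 0 ≤ u * (a / s) ^ p := by positivity
          rw [indicator_of_mem (by exact hsb), lintegral_expNeg_expMeasure_one h0,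
            ENNReal.ofReal_sub _ (by positivity), ENNReal.ofReal_one]
        · have hsb' : ¬ b * (1 / s) < 1 := fun h' => hsb ((mul_one_div_lt_one_iff hs0).1 h')
          have : ∀ g, F (1 / s, g) = 0 := by
            intro g; simp only [hF]
            rw [indicator_of_notMem hn, zero_add, if_neg hsb']
          rw [indicator_of_notMem (by exact hsb)]
          simp_rw [this]
          simp
    rw [setLIntegral_congr_fun measurableSet_Ioi hval,
      lintegral_add_left (measurable_const.indicator measurableSet_Ioc),
      lintegral_indicator measurableSet_Ioc, lintegral_indicator measurableSet_Ioi,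
      Measure.restrict_restrict measurableSet_Ioc, Measure.restrict_restrict measurableSet_Ioi,
      inter_eq_left.2 Ioc_subset_Ioi_self, inter_eq_left.2 (Ioi_subset_Ioi (hv.trans hvb)),
      setLIntegral_one, Real.volume_Ioc, sub_zero]
    rfl
  rw [hint, mul_add, expNeg_add, ← ENNReal.ofReal_mul hc, expNeg_ofReal (mul_nonneg hc hv)]
  ring

lemma expMeasure_Ioc (hc : 0 < c) {a b : ℝ} (ha : 0 ≤ a) (hab : a ≤ b) :
    expMeasure c (Ioc a b) =
      ENNReal.ofReal (Real.exp (-(c * a))) - ENNReal.ofReal (Real.exp (-(c * b))) := by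
  have := isProbabilityMeasure_expMeasure hc
  have hIic : ∀ x, 0 ≤ x → (expMeasure c).real (Iic x) = 1 - Real.exp (-(c * x)) := by
    intro x hx
    rw [← cdf_eq_real, cdf_expMeasure_eq hc, if_pos hx]
  rw [← Iic_sdiff_Iic, ← ofReal_measureReal, measureReal_sdiff (Iic_subset_Iic.2 hab)
    measurableSet_Iic, hIic a ha, hIic b (ha.trans hab), ← ENNReal.ofReal_sub _ (Real.exp_pos _).le]
  congr 1; ring

/-- The contribution of the event that the nearest point lies in `(a, b]`. -/
lemma lintegral_cell_load [IsProbabilityMeasure μ] (h : IsPoissonGain μ W G c) (hc : 0 < c)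
    {u κ p : ℝ} (hu : 0 < u) (hκ : 0 ≤ κ) (hp : 1 < p) {a b : ℝ} (ha : 0 ≤ a) (hab : a ≤ b) :
    ∫⁻ ω, {ω | (∀ i, a * W i ω < 1) ∧ ¬ ∀ i, b * W i ω < 1}.indicator
      (fun ω => expNeg (ENNReal.ofReal u * load W G κ p (a, b) ω)) ω ∂μ =
      expMeasure c (Ioc a b) * (ENNReal.ofReal (Real.exp (-(u * (κ * a ^ p)))) *
        expNeg (ENNReal.ofReal c * tailRate u p (a, b))) := by
  set f := fun ω => expNeg (ENNReal.ofReal u * load W G κ p (a, b) ω) with hf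
  have hfm : Measurable f := measurable_expNeg.comp ((h.measurable_load κ p (a, b)).const_mul _)
  -- Since `a ≤ b`, a void up to `b` implies a void up to `a`, so the indicator of the cell is the
  -- difference of the two void indicators.
  have hsub : ∀ ω, {ω | (∀ i, a * W i ω < 1) ∧ ¬ ∀ i, b * W i ω < 1}.indicator f ω =
      {ω | ∀ i, a * W i ω < 1}.indicator f ω - {ω | ∀ i, b * W i ω < 1}.indicator f ω := by
    intro ω
    by_cases hb : ∀ i, b * W i ω < 1
    · have ha' : ∀ i, a * W i ω < 1 := fun i =>
        (mul_le_mul_of_nonneg_right hab (h.nonneg i ω)).trans_lt (hb i)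
      rw [indicator_of_notMem (fun h' => h'.2 hb), indicator_of_mem (by exact ha'),
        indicator_of_mem (by exact hb), tsub_self]
    · rw [indicator_of_notMem (s := {ω | ∀ i, b * W i ω < 1}) (by exact hb), tsub_zero]
      by_cases ha' : ∀ i, a * W i ω < 1
      · rw [indicator_of_mem (by exact ⟨ha', hb⟩), indicator_of_mem (by exact ha')]
      · rw [indicator_of_notMem (fun h' => ha' h'.1), indicator_of_notMem (by exact ha')]
  simp_rw [hsub]
  have h1 := h.lintegral_void_load hc.le hu hκ hp ha ha hab
  have h2 := h.lintegral_void_load hc.le hu hκ hp ha (ha.trans hab) le_rfl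
  rw [lintegral_sub (hfm.indicator (h.measurableSet_void b)), h1, h2, expMeasure_Ioc hc ha hab,
    ENNReal.sub_mul]
  · intro _ _
    exact ENNReal.mul_ne_top ENNReal.ofReal_ne_top (expNeg_ne_top _)
  · rw [h2]
    exact ENNReal.mul_ne_top ENNReal.ofReal_ne_top
      (ENNReal.mul_ne_top ENNReal.ofReal_ne_top (expNeg_ne_top _))
  · refine ae_of_all _ fun ω => ?_
    by_cases hb : ∀ i, b * W i ω < 1
    · have ha' : ∀ i, a * W i ω < 1 := fun i =>
        (mul_le_mul_of_nonneg_right hab (h.nonneg i ω)).trans_lt (hb i)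
      rw [indicator_of_mem (by exact hb), indicator_of_mem (by exact ha')]
    · rw [indicator_of_notMem (by exact hb)]; exact zero_le

lemma measurable_maxGain {W : ℕ → Ω → ℝ} (hW : ∀ i, Measurable (W i)) : Measurable (maxGain W) :=
  (Measurable.iSup fun i => (hW i).ennreal_ofReal).ennreal_toReal

/-- The inverse of the strongest signal-to-interference-and-noise ratio without its own fading. -/
noncomputable def totalLoad (W G : ℕ → Ω → ℝ) (κ p : ℝ) (ω : Ω) : ℝ≥0∞ :=
  load W G κ p (1 / maxGain W ω, 1 / maxGain W ω) ω

lemma measurable_totalLoad (hW : ∀ i, Measurable (W i)) (hG : ∀ i, Measurable (G i)) (κ p : ℝ) :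
    Measurable (totalLoad W G κ p) := by
  have hm := measurable_maxGain hW
  unfold totalLoad load
  have h0 : Measurable fun ω => ENNReal.ofReal (κ * (1 / maxGain W ω) ^ p) := by fun_prop
  refine h0.add (Measurable.tsum fun i => ?_)
  have h1 := hW i
  have h2 := hG i
  exact Measurable.ite (measurableSet_lt (by fun_prop) measurable_const) (by fun_prop)
    measurable_const

/-- Laplace transform of the load: the strongest gain is averaged out last. -/
theorem lintegral_expNeg_totalLoad [IsProbabilityMeasure μ] (h : IsPoissonGain μ W G c)
    (hc : 0 < c) (hG : ∀ᵐ ω ∂μ, ∀ i, 0 ≤ G i ω) {u κ p : ℝ} (hu : 0 < u) (hκ : 0 ≤ κ)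
    (hp : 1 < p) :
    ∫⁻ ω, expNeg (ENNReal.ofReal u * totalLoad W G κ p ω) ∂μ =
      ∫⁻ d, ENNReal.ofReal (Real.exp (-(u * (κ * d ^ p)) - c * d * IG u (1 / p)))
        ∂(expMeasure c) := by
  have hp0 : 0 < p := by linarith
  have hprob := isProbabilityMeasure_expMeasure hc
  set Ψ : ℝ × ℝ → ℝ≥0∞ := fun q => ENNReal.ofReal (Real.exp (-(u * (κ * q.1 ^ p)))) *
    expNeg (ENNReal.ofReal c * tailRate u p q) with hΨ
  set E : ℕ → ℕ → Set Ω := fun n k =>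
    {ω | (∀ i, node n k * W i ω < 1) ∧ ¬ ∀ i, node n (k + 1) * W i ω < 1} with hE
  have hEm : ∀ n k, MeasurableSet (E n k) := fun n k =>
    (h.measurableSet_void _).inter (h.measurableSet_void _).compl
  set f : ℕ → ℕ → Ω → ℝ≥0∞ := fun n k ω =>
    expNeg (ENNReal.ofReal u * load W G κ p (node n k, node n (k + 1)) ω) with hf
  have hfm : ∀ n k, Measurable (f n k) := fun n k =>
    measurable_expNeg.comp ((h.measurable_load κ p _).const_mul _)
  have hexpos := ae_pos_expMeasure hc
  -- At mesh `n`, the probability that the nearest point is in a cell is the `Exp(c)` mass of that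
  -- cell. The left side is thus already an integral of a step function against `Exp(c)`, and both
  -- sides are then passed to the limit.
  have hcell : ∀ n, ∫⁻ ω, ∑' k, (E n k).indicator (f n k) ω ∂μ =
      ∫⁻ d, ∑' k, {D' | node n k < D' ∧ D' ≤ node n (k + 1)}.indicator
        (fun _ => Ψ (node n k, node n (k + 1))) d ∂(expMeasure c) := by
    intro n
    have hms : ∀ k, MeasurableSet {D' | node n k < D' ∧ D' ≤ node n (k + 1)} := fun k =>
      measurableSet_Ioc
    rw [lintegral_tsum (fun k => ((hfm n k).indicator (hEm n k)).aemeasurable),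
      lintegral_tsum (fun k => (measurable_const.indicator (hms k)).aemeasurable)]
    refine tsum_congr fun k => ?_
    rw [lintegral_indicator_const (hms k), mul_comm (Ψ _)]
    exact h.lintegral_cell_load hc hu hκ hp (node_nonneg n k) (node_le_succ n k)
  -- Cells are disjoint, so at most one term is nonzero; this gives the dominating constant `1` on
  -- both sides.
  have hsum_le : ∀ (n : ℕ) (S : ℕ → Prop) (g : ℕ → ℝ≥0∞), (∀ k l, S k → S l → k = l) →
      (∀ k, g k ≤ 1) → ∑' k, {k | S k}.indicator g k ≤ 1 := by
    intro n S g hS hg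
    by_cases hex : ∃ k, S k
    · obtain ⟨k, hk⟩ := hex
      have hz : ∀ l, l ≠ k → {k | S k}.indicator g l = 0 := fun l hl =>
        indicator_of_notMem (fun hl' => hl (hS l k hl' hk)) _
      rw [tsum_eq_single k hz]
      exact (indicator_le_self _ _ k).trans (hg k)
    · have : ∀ k, {k | S k}.indicator g k = 0 := fun k =>
        indicator_of_notMem (fun hk => hex ⟨k, hk⟩) _
      simp [this]
  have hmax := h.ae_exists_max hc
  have hEiff : ∀ᵐ ω ∂μ, 0 < 1 / maxGain W ω ∧ ∀ n k, (ω ∈ E n k ↔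
      node n k < 1 / maxGain W ω ∧ 1 / maxGain W ω ≤ node n (k + 1)) := by
    filter_upwards [hmax] with ω ⟨i, hi, hlt⟩
    have hle : ∀ j, W j ω ≤ W i ω := fun j => by
      rcases eq_or_ne j i with rfl | hj
      · exact le_rfl
      · exact (hlt j hj).le
    rw [maxGain_eq hi.le hle]
    have hvoid : ∀ b : ℝ, 0 ≤ b → ((∀ j, b * W j ω < 1) ↔ b < 1 / W i ω) := by
      intro b hb
      rw [lt_div_iff₀ hi]
      exact ⟨fun h' => h' i, fun h' j => (mul_le_mul_of_nonneg_left (hle j) hb).trans_lt h'⟩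
    refine ⟨by positivity, fun n k => ?_⟩
    rw [hE, mem_ofPred_eq, hvoid _ (node_nonneg _ _), hvoid _ (node_nonneg _ _), not_lt]
  have hL : Tendsto (fun n => ∫⁻ ω, ∑' k, (E n k).indicator (f n k) ω ∂μ) atTop
      (𝓝 (∫⁻ ω, expNeg (ENNReal.ofReal u * totalLoad W G κ p ω) ∂μ)) := by
    refine tendsto_lintegral_of_dominated_convergence' (fun _ => 1)
      (fun n => (Measurable.tsum fun k => (hfm n k).indicator (hEm n k)).aemeasurable)
      (fun n => ?_) (by simp) ?_
    · filter_upwards [hEiff] with ω ⟨_, hω⟩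
      refine hsum_le n (fun k => ω ∈ E n k) (fun k => f n k ω) (fun k l hk hl => ?_)
        (fun k => expNeg_le_one _)
      exact node_unique ((hω n k).1 hk) ((hω n l).1 hl)
    · filter_upwards [hEiff, hG] with ω ⟨hpos, hω⟩ hGω
      have ht := tendsto_load (κ := κ) (p := p) (D := 1 / maxGain W ω)
        (fun i => h.nonneg i ω) hGω hp0
      have ht' := (continuous_expNeg.tendsto _).comp
        (ENNReal.Tendsto.const_mul (a := ENNReal.ofReal u) ht (Or.inr ENNReal.ofReal_ne_top))
      refine (tendsto_tsum_cells hpos ht').congr fun n => tsum_congr fun k => ?_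
      by_cases hk : ω ∈ E n k
      · rw [indicator_of_mem hk, indicator_of_mem (by exact (hω n k).1 hk)]; rfl
      · have hk' : 1 / maxGain W ω ∉ {D' | node n k < D' ∧ D' ≤ node n (k + 1)} :=
          fun h' => hk ((hω n k).2 h')
        rw [indicator_of_notMem hk, indicator_of_notMem hk']
  have hR : Tendsto (fun n => ∫⁻ d, ∑' k, {D' | node n k < D' ∧ D' ≤ node n (k + 1)}.indicator
        (fun _ => Ψ (node n k, node n (k + 1))) d ∂(expMeasure c)) atTop
      (𝓝 (∫⁻ d, ENNReal.ofReal (Real.exp (-(u * (κ * d ^ p)) - c * d * IG u (1 / p)))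
        ∂(expMeasure c))) := by
    refine tendsto_lintegral_of_dominated_convergence' (fun _ => 1) (fun n => ?_) (fun n => ?_)
      (by simp) ?_
    · exact (Measurable.tsum fun k => measurable_const.indicator measurableSet_Ioc).aemeasurable
    · refine ae_of_all _ fun d => ?_
      refine hsum_le n (fun k => node n k < d ∧ d ≤ node n (k + 1))
        (fun k => Ψ (node n k, node n (k + 1))) (fun k l hk hl => node_unique hk hl) fun k => ?_
      refine mul_le_one' ?_ (expNeg_le_one _)
      rw [ENNReal.ofReal_le_one, Real.exp_le_one_iff, neg_nonpos]
      have := node_nonneg n k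
      positivity
    · filter_upwards [hexpos] with d hd
      refine tendsto_tsum_cells hd ?_
      have hval : ENNReal.ofReal (Real.exp (-(u * (κ * d ^ p)) - c * d * IG u (1 / p))) =
          Ψ (d, d) := by
        have hIG := IG_nonneg (u := u) hu hp
        rw [hΨ]
        simp only [tailRate]
        rw [lintegral_interference hu hp hd, ← ENNReal.ofReal_mul hc.le,
          expNeg_ofReal (by positivity), ← ENNReal.ofReal_mul (Real.exp_pos _).le, ← Real.exp_add]
        congr 2; ring
      rw [hval]
      have hfst : Tendsto (fun q : ℝ × ℝ => q.1) (𝓝[bracket d] (d, d)) (𝓝 d) :=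
        (continuous_fst.tendsto (d, d)).mono_left nhdsWithin_le_nhds
      refine ENNReal.Tendsto.mul ?_ (Or.inr (expNeg_ne_top _)) ?_ (Or.inr ENNReal.ofReal_ne_top)
      · refine (ENNReal.continuous_ofReal.tendsto _).comp ((Real.continuous_exp.tendsto _).comp ?_)
        exact (((hfst.rpow_const (Or.inr hp0.le)).const_mul κ).const_mul u).neg
      · exact (continuous_expNeg.tendsto _).comp (ENNReal.Tendsto.const_mul
          (tendsto_tailRate hu hp hd) (Or.inr ENNReal.ofReal_ne_top))
  refine tendsto_nhds_unique hL ?_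
  simp_rw [hcell]
  exact hR

end IsPoissonGain

/-! ### Gamma tails and differentiation in `t` -/

/-- The weight `e^{-y} y^k / k!` of the Poisson law. -/
noncomputable def poissonWeight (k : ℕ) (y : ℝ) : ℝ := y ^ k / (k.factorial : ℝ) * Real.exp (-y)

/-- `e^{-y} ∑_{k ≤ m} y^k / k!`, the tail of the `Gamma (m + 1, 1)` law. -/
noncomputable def gammaTail (m : ℕ) (y : ℝ) : ℝ := ∑ k ∈ Finset.range (m + 1), poissonWeight k y

lemma gammaTail_succ (m : ℕ) (y : ℝ) :
    gammaTail (m + 1) y = gammaTail m y + poissonWeight (m + 1) y := Finset.sum_range_succ _ _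

@[fun_prop] lemma measurable_poissonWeight (k : ℕ) : Measurable (poissonWeight k) := by
  unfold poissonWeight; fun_prop

@[fun_prop] lemma measurable_gammaTail (m : ℕ) : Measurable (gammaTail m) := by
  unfold gammaTail
  exact Finset.measurable_sum _ fun k _ => measurable_poissonWeight k

lemma poissonWeight_nonneg (k : ℕ) {y : ℝ} (hy : 0 ≤ y) : 0 ≤ poissonWeight k y := by
  unfold poissonWeight; positivity

lemma gammaTail_nonneg (m : ℕ) {y : ℝ} (hy : 0 ≤ y) : 0 ≤ gammaTail m y :=
  Finset.sum_nonneg fun k _ => poissonWeight_nonneg k hy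

lemma poissonWeight_le_one (k : ℕ) {y : ℝ} (hy : 0 ≤ y) : poissonWeight k y ≤ 1 := by
  rw [poissonWeight, Real.exp_neg, ← div_eq_mul_inv, div_le_one (Real.exp_pos y)]
  exact Real.pow_div_factorial_le_exp y hy k

lemma gammaTail_le_one (m : ℕ) {y : ℝ} (hy : 0 ≤ y) : gammaTail m y ≤ 1 := by
  simp only [gammaTail, poissonWeight]
  rw [← Finset.sum_mul, Real.exp_neg, ← div_eq_mul_inv, div_le_one (Real.exp_pos y)]
  exact Real.sum_le_exp_of_nonneg hy _

/-- The derivative of the weight of index `k + 1` is the weight of index `k` minus itself, so the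
sum telescopes to its last term. -/
lemma hasDerivAt_gammaTail (m : ℕ) (y : ℝ) : HasDerivAt (gammaTail m) (-poissonWeight m y) y := by
  have hexp : HasDerivAt (fun y : ℝ => Real.exp (-y)) (-Real.exp (-y)) y := by
    simpa using (hasDerivAt_neg y).exp
  induction m with
  | zero =>
    have e : gammaTail 0 = fun y => Real.exp (-y) := by
      ext; simp [gammaTail, poissonWeight]
    rw [e]
    simpa [poissonWeight] using hexp
  | succ m ih =>
    have e : gammaTail (m + 1) = fun y => gammaTail m y + poissonWeight (m + 1) y :=
      funext (gammaTail_succ m)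
    rw [e]
    have h1 : HasDerivAt (poissonWeight (m + 1)) (poissonWeight m y - poissonWeight (m + 1) y) y := by
      unfold poissonWeight
      refine (((hasDerivAt_pow (m + 1) y).div_const ((m + 1).factorial : ℝ)).mul hexp).congr_deriv ?_
      rw [Nat.factorial_succ]
      push_cast
      have : (m.factorial : ℝ) ≠ 0 := by positivity
      field_simp
      ring
    exact (ih.add h1).congr_deriv (by ring)

/-- The shape is `m + 1`, so the density is `poissonWeight m`, whose antiderivative vanishing at
infinity is `-gammaTail m`. -/
lemma gammaMeasure_Ici (m : ℕ) {y : ℝ} (hy : 0 ≤ y) :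
    gammaMeasure ((m + 1 : ℕ) : ℝ) 1 (Ici y) = ENNReal.ofReal (gammaTail m y) := by
  have hderiv : ∀ x ∈ Ici y, HasDerivAt (fun x => -gammaTail m x) (poissonWeight m x) x :=
    fun x _ => (hasDerivAt_gammaTail m x).neg.congr_deriv (neg_neg _)
  have hpos : ∀ x ∈ Ioi y, 0 ≤ poissonWeight m x := fun x hx =>
    poissonWeight_nonneg m (hy.trans (le_of_lt hx))
  have hlim : Tendsto (fun x => -gammaTail m x) atTop (𝓝 0) := by
    have : Tendsto (gammaTail m) atTop (𝓝 0) := by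
      have h1 : ∀ k ∈ Finset.range (m + 1), Tendsto (poissonWeight k) atTop (𝓝 0) := by
        intro k _
        have := (Real.tendsto_pow_mul_exp_neg_atTop_nhds_zero k).div_const (k.factorial : ℝ)
        rw [zero_div] at this
        refine this.congr fun x => ?_
        rw [poissonWeight]; ring
      have := tendsto_finsetSum _ h1
      rw [Finset.sum_const_zero] at this
      exact this
    simpa using this.neg
  have hint := integral_Ioi_of_hasDerivAt_of_nonneg' hderiv hpos hlim
  have hi := integrableOn_Ioi_deriv_of_nonneg' hderiv hpos hlim
  rw [gammaMeasure, withDensity_apply _ measurableSet_Ici, setLIntegral_congr Ioi_ae_eq_Ici.symm]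
  have e : ∀ x ∈ Ioi y, gammaPDF ((m + 1 : ℕ) : ℝ) 1 x = ENNReal.ofReal (poissonWeight m x) := by
    intro x hx
    rw [gammaPDF_of_nonneg (hy.trans (le_of_lt hx))]
    congr 1
    have : ((m + 1 : ℕ) : ℝ) - 1 = (m : ℝ) := by push_cast; ring
    rw [this, Real.one_rpow, Real.rpow_natCast, poissonWeight]
    push_cast
    rw [Real.Gamma_nat_eq_factorial]
    ring_nf
  rw [setLIntegral_congr_fun measurableSet_Ioi e,
    ← ofReal_integral_eq_lintegral_ofReal hi ((ae_restrict_iff' measurableSet_Ioi).2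
      (ae_of_all _ hpos)), hint]
  congr 1; ring

section Derivative

variable {Ω : Type*} [MeasurableSpace Ω] {μ : Measure Ω} [IsFiniteMeasure μ] {Y : Ω → ℝ}

/-- The mean of `gammaTail m (Y / t)`. -/
noncomputable def meanTail (μ : Measure Ω) (Y : Ω → ℝ) (m : ℕ) (t : ℝ) : ℝ :=
  ∫ ω, gammaTail m (Y ω / t) ∂μ

lemma integrable_gammaTail (hY : Measurable Y) (hY0 : ∀ ω, 0 ≤ Y ω) (m : ℕ) {t : ℝ} (ht : 0 < t) :
    Integrable (fun ω => gammaTail m (Y ω / t)) μ := by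
  refine Integrable.of_bound (C := 1) (Measurable.aestronglyMeasurable (by fun_prop))
    (ae_of_all _ fun ω => ?_)
  have h0 : 0 ≤ Y ω / t := div_nonneg (hY0 ω) ht.le
  rw [Real.norm_of_nonneg (gammaTail_nonneg m h0)]
  exact gammaTail_le_one m h0

/-- The chain rule gives `(y / t²) * poissonWeight m (y / t)`, which equals `((m + 1) / t) *
poissonWeight (m + 1) (y / t)`. Poisson weights are at most `1`, so on `s > t / 2` the derivative is
bounded by a constant and no moment of `Y` is needed. -/
lemma hasDerivAt_meanTail (hY : Measurable Y) (hY0 : ∀ ω, 0 ≤ Y ω) (m : ℕ) {t : ℝ} (ht : 0 < t) :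
    HasDerivAt (meanTail μ Y m)
      (((m : ℝ) + 1) / t * (meanTail μ Y (m + 1) t - meanTail μ Y m t)) t := by
  have key := hasDerivAt_integral_of_dominated_loc_of_deriv_le (μ := μ) (x₀ := t)
    (s := Ioi (t / 2)) (F := fun s ω => gammaTail m (Y ω / s))
    (F' := fun s ω => ((m : ℝ) + 1) / s * poissonWeight (m + 1) (Y ω / s))
    (bound := fun _ => ((m : ℝ) + 1) / (t / 2)) (Ioi_mem_nhds (by linarith))
    (Eventually.of_forall fun s => Measurable.aestronglyMeasurable (by fun_prop))
    (integrable_gammaTail hY hY0 m ht) (Measurable.aestronglyMeasurable (by fun_prop))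
    (ae_of_all _ fun ω s hs => ?_) (integrable_const _) (ae_of_all _ fun ω s hs => ?_)
  · refine key.2.congr_deriv ?_
    rw [integral_const_mul, meanTail, meanTail,
      ← integral_sub (integrable_gammaTail hY hY0 _ ht) (integrable_gammaTail hY hY0 _ ht)]
    congr 2
    ext ω
    rw [gammaTail_succ]; ring
  · have hs' : t / 2 < s := hs
    have hs0 : 0 < s := by linarith
    have h0 : 0 ≤ Y ω / s := div_nonneg (hY0 ω) hs0.le
    have h1 := poissonWeight_le_one (m + 1) h0
    have h2 := poissonWeight_nonneg (m + 1) h0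
    rw [Real.norm_of_nonneg (by positivity)]
    calc _ ≤ ((m : ℝ) + 1) / s * 1 := by gcongr
      _ ≤ _ := by rw [mul_one]; gcongr
  · have hs' : t / 2 < s := hs
    have hs0 : 0 < s := by linarith
    have h1 : HasDerivAt (fun s => Y ω / s) (-Y ω / s ^ 2) s := by
      have := (hasDerivAt_inv hs0.ne').const_mul (Y ω)
      refine (this.congr_deriv (by ring)).congr_of_eventuallyEq ?_
      exact Eventually.of_forall fun s => div_eq_mul_inv _ _
    have h2 := (hasDerivAt_gammaTail m (Y ω / s)).comp s h1
    refine h2.congr_deriv ?_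
    unfold poissonWeight
    rw [Nat.factorial_succ]
    push_cast
    have : (m.factorial : ℝ) ≠ 0 := by positivity
    rw [pow_succ (Y ω / s)]
    field_simp

/-- The derivative is again a combination of mean tails, of indices `m` and `m + 1`; hence the
induction on the order for all `m` at once. -/
lemma contDiffOn_meanTail (hY : Measurable Y) (hY0 : ∀ ω, 0 ≤ Y ω) (n : ℕ) :
    ∀ m, ContDiffOn ℝ (n : WithTop ℕ∞) (meanTail μ Y m) (Ioi 0) := by
  induction n with
  | zero =>
    intro m
    rw [Nat.cast_zero, contDiffOn_zero]
    exact fun t ht => (hasDerivAt_meanTail hY hY0 m ht).continuousAt.continuousWithinAt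
  | succ n ih =>
    intro m
    push_cast
    rw [contDiffOn_succ_iff_deriv_of_isOpen isOpen_Ioi]
    refine ⟨fun t ht =>
      (hasDerivAt_meanTail hY hY0 m ht).differentiableAt.differentiableWithinAt, by simp, ?_⟩
    have : ContDiffOn ℝ (n : WithTop ℕ∞) (fun t => ((m : ℝ) + 1) / t *
        (meanTail μ Y (m + 1) t - meanTail μ Y m t)) (Ioi 0) :=
      (contDiffOn_const.div contDiffOn_id fun t ht => ne_of_gt ht).mul ((ih _).sub (ih _))
    exact this.congr fun t ht => (hasDerivAt_meanTail hY hY0 m ht).deriv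

lemma iteratedDeriv_id_mul {A : ℝ → ℝ} {t : ℝ} (n : ℕ)
    (hA : ContDiffAt ℝ ((n + 1 : ℕ) : WithTop ℕ∞) A t) :
    iteratedDeriv (n + 1) (fun s => s * A s) t =
      t * iteratedDeriv (n + 1) A t + ((n : ℝ) + 1) * iteratedDeriv n A t := by
  rw [iteratedDeriv_fun_mul contDiffAt_fun_id hA, Finset.sum_range_succ', Finset.sum_range_succ',
    Finset.sum_eq_zero]
  · simp only [zero_add, iteratedDeriv_one, iteratedDeriv_zero, Nat.choose_zero_right,
      Nat.choose_one_right, Nat.sub_zero, Nat.add_sub_cancel, deriv_id'']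
    push_cast
    ring
  · intro i _
    have : iteratedDeriv (i + 1 + 1) (fun s : ℝ => s) = 0 := by
      rw [iteratedDeriv_succ', iteratedDeriv_succ']
      ext; simp
    rw [this]; simp

/-- `d^m/dt^m (t^m / m! · 𝔼 e^{-Y/t}) = 𝔼 [gammaTail m (Y / t)]`. -/
theorem iteratedDeriv_pow_mul_meanTail (hY : Measurable Y) (hY0 : ∀ ω, 0 ≤ Y ω) (m : ℕ) :
    ∀ t : ℝ, 0 < t → iteratedDeriv m
      (fun s => s ^ m / (m.factorial : ℝ) * meanTail μ Y 0 s) t = meanTail μ Y m t := by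
  induction m with
  | zero => intro t _; simp
  | succ m ih =>
    intro t ht
    set A : ℝ → ℝ := fun s => s ^ m / (m.factorial : ℝ) * meanTail μ Y 0 s with hA
    have hAc : ContDiffAt ℝ ((m + 1 : ℕ) : WithTop ℕ∞) A t := by
      refine ContDiffAt.mul (by fun_prop) ?_
      exact (contDiffOn_meanTail hY hY0 (m + 1) 0).contDiffAt (Ioi_mem_nhds ht)
    have e : (fun s => s ^ (m + 1) / ((m + 1).factorial : ℝ) * meanTail μ Y 0 s) =
        fun s => (1 / ((m : ℝ) + 1)) * (s * A s) := by
      ext s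
      simp only [hA]
      rw [Nat.factorial_succ]
      push_cast
      have : (m.factorial : ℝ) ≠ 0 := by positivity
      field_simp
      ring
    -- With `M m` for `meanTail μ Y m`, Leibniz and the induction hypothesis give `(t / (m + 1)) *
    -- (M m)' + M m`, which is `M (m + 1)` by the derivative formula.
    rw [e, iteratedDeriv_const_mul_field, iteratedDeriv_id_mul m hAc, ih t ht, iteratedDeriv_succ]
    have hev : iteratedDeriv m A =ᶠ[𝓝 t] meanTail μ Y m := by
      filter_upwards [Ioi_mem_nhds ht] with s hs using ih s hs
    rw [hev.deriv_eq, (hasDerivAt_meanTail hY hY0 m ht).deriv]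
    have : (m : ℝ) + 1 ≠ 0 := by positivity
    field_simp
    ring

end Derivative

/-! ### Facts on the fading laws and positivity of `ω` -/

lemma ae_pos_gammaMeasure {a r : ℝ} : ∀ᵐ x ∂(gammaMeasure a r), 0 < x := by
  rw [ae_iff]
  have : {x : ℝ | ¬ 0 < x} = Iic 0 := by ext; simp
  rw [this, gammaMeasure, withDensity_apply _ measurableSet_Iic,
    setLIntegral_congr Iio_ae_eq_Iic.symm]
  have e : ∀ x ∈ Iio (0 : ℝ), gammaPDF a r x = 0 := fun x hx => gammaPDF_of_neg hx
  rw [setLIntegral_congr_fun measurableSet_Iio e, lintegral_zero]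

lemma integral_id_expMeasure_one : ∫ x, x ∂(expMeasure 1) = 1 := by
  have hm : Measurable (gammaPDF 1 1) := (measurable_gammaPDFReal 1 1).ennreal_ofReal
  have hG := Real.GammaIntegral_convergent (s := 2) (by norm_num)
  rw [integral_eq_lintegral_of_nonneg_ae
    (by filter_upwards [ae_pos_expMeasure one_pos] with x hx using hx.le)
    measurable_id'.aestronglyMeasurable, expMeasure, gammaMeasure,
    lintegral_withDensity_eq_lintegral_mul _ hm (by fun_prop)]
  have e : ∫⁻ x, (gammaPDF 1 1 * fun x => ENNReal.ofReal x) x =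
      ∫⁻ x in Ioi (0 : ℝ), ENNReal.ofReal (Real.exp (-x) * x ^ ((2 : ℝ) - 1)) := by
    rw [← lintegral_indicator measurableSet_Ioi]
    refine lintegral_congr_ae ?_
    filter_upwards [Measure.ae_ne volume (0 : ℝ)] with x hx
    rcases lt_or_gt_of_ne hx with h | h
    · rw [indicator_of_notMem (by simp [h.le]), Pi.mul_apply, gammaPDF_of_neg h, zero_mul]
    · rw [indicator_of_mem (by exact h), Pi.mul_apply, gammaPDF_of_nonneg h.le,
        ← ENNReal.ofReal_mul (by simp; positivity)]
      congr 1
      norm_num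
  rw [e, ← ofReal_integral_eq_lintegral_ofReal hG, ← Real.Gamma_eq_integral (by norm_num),
    Real.Gamma_two]
  · simp
  · refine (ae_restrict_iff' measurableSet_Ioi).2 (ae_of_all _ fun y hy => ?_)
    have : 0 < y := hy
    change (0 : ℝ) ≤ _
    positivity

lemma gammaMeasure_ofReal_le (m : ℕ) {y : ℝ} (hy : 0 ≤ y) :
    gammaMeasure ((m + 1 : ℕ) : ℝ) 1 {g | ENNReal.ofReal y ≤ ENNReal.ofReal g} =
      ENNReal.ofReal (gammaTail m y) := by
  rw [← gammaMeasure_Ici m hy]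
  refine measure_congr ?_
  filter_upwards [ae_pos_gammaMeasure (a := ((m + 1 : ℕ) : ℝ)) (r := 1)] with g hg
  exact propext (ENNReal.ofReal_le_ofReal_iff hg.le)

/-- Angles below `π / 2` have positive cosine. The remaining factor is positive even for `ell = 0`,
because the line-of-sight probability is. -/
lemma omega_pos {α ell c₁ c₂ : ℝ} {ν : Measure ℝ} [IsProbabilityMeasure ν]
    (hell : ell ∈ Icc (0 : ℝ) 1) (hα : 0 < α) (hc₂ : 0 < c₂)
    (hν : ∀ᵐ θ ∂ν, θ ∈ Ico 0 (Real.pi / 2)) : 0 < omega α ell c₁ c₂ ν := by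
  have he := Real.rpow_nonneg hell.1 (2 / α)
  have he1 : ell ^ (2 / α) ≤ 1 := Real.rpow_le_one hell.1 hell.2 (by positivity)
  have hpos : ∀ θ, Real.cos θ ≠ 0 →
      0 < Real.cos θ ^ 2 * (losProb c₁ c₂ θ * (1 - ell ^ (2 / α)) + ell ^ (2 / α)) := by
    intro θ hθ
    have h0 := losProb_pos (c₁ := c₁) hc₂ θ
    have h1 := losProb_le_one (c₁ := c₁) hc₂ θ
    refine mul_pos (by positivity) ?_
    rcases he.eq_or_lt with h | h
    · rw [← h]; simpa using h0
    · have := mul_nonneg h0.le (sub_nonneg.2 he1); linarith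
  have hcos : ∀ᵐ θ ∂ν, Real.cos θ ≠ 0 := by
    filter_upwards [hν] with θ hθ
    exact (Real.cos_pos_of_mem_Ioo ⟨by linarith [hθ.1, Real.pi_pos], hθ.2⟩).ne'
  have hint : Integrable (fun θ => Real.cos θ ^ 2 *
      (losProb c₁ c₂ θ * (1 - ell ^ (2 / α)) + ell ^ (2 / α))) ν := by
    refine Integrable.of_bound (C := 1) (Measurable.aestronglyMeasurable (by fun_prop))
      (ae_of_all _ fun θ => ?_)
    have h0 := losProb_pos (c₁ := c₁) hc₂ θ
    have h1 := losProb_le_one (c₁ := c₁) hc₂ θ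
    have h2 : 0 ≤ losProb c₁ c₂ θ * (1 - ell ^ (2 / α)) + ell ^ (2 / α) :=
      add_nonneg (mul_nonneg h0.le (sub_nonneg.2 he1)) he
    rw [Real.norm_of_nonneg (mul_nonneg (sq_nonneg _) h2)]
    refine mul_le_one₀ (Real.cos_sq_le_one θ) h2 ?_
    have := mul_le_mul_of_nonneg_right h1 (sub_nonneg.2 he1)
    linarith
  rw [omega, integral_pos_iff_support_of_nonneg_ae _ hint]
  · have : ν (Function.support fun θ => Real.cos θ ^ 2 *
        (losProb c₁ c₂ θ * (1 - ell ^ (2 / α)) + ell ^ (2 / α))) = ν univ := by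
      refine measure_congr ?_
      filter_upwards [hcos] with θ hθ
      exact propext ⟨fun _ => trivial, fun _ => (hpos θ hθ).ne'⟩
    rw [this]; simp
  · filter_upwards [hcos] with θ hθ using (hpos θ hθ).le

/-! ### From the physical model to gains and load -/

namespace Network

variable {Ω : Type*} {net : Network Ω}

lemma norm_U {i : ℕ} {ω : Ω} (hΘ : net.Θ i ω ∈ Ico 0 (Real.pi / 2)) :
    ‖net.U i ω‖ = ‖net.X i ω‖ / Real.cos (net.Θ i ω) := by
  have hcos : 0 < Real.cos (net.Θ i ω) :=
    Real.cos_pos_of_mem_Ioo ⟨by linarith [hΘ.1, Real.pi_pos], hΘ.2⟩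
  have h1 : ‖net.U i ω‖ ^ 2 = (‖net.X i ω‖ / Real.cos (net.Θ i ω)) ^ 2 := by
    rw [U, WithLp.prod_norm_sq_eq_of_L2]
    change ‖net.X i ω‖ ^ 2 + |‖net.X i ω‖ * Real.tan (net.Θ i ω)| ^ 2 = _
    rw [sq_abs, Real.tan_eq_sin_div_cos]
    field_simp
    have := Real.sin_sq_add_cos_sq (net.Θ i ω)
    linear_combination ‖net.X i ω‖ ^ 2 * this
  exact (sq_eq_sq₀ (norm_nonneg _) (by positivity)).1 h1

/-- This is the reduction of the three-dimensional path loss to the planar gain. It also holds for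
`X i = 0`, where division by zero makes both sides zero. -/
lemma L_mul_norm_U_rpow {α ell : ℝ} (hα : 0 < α) (hell : 0 ≤ ell) {i : ℕ} {ω : Ω}
    (hΘ : net.Θ i ω ∈ Ico 0 (Real.pi / 2)) :
    net.L ell i ω * ‖net.U i ω‖ ^ (-α) = net.gain α ell i ω ^ (α / 2) := by
  have hcos : 0 < Real.cos (net.Θ i ω) :=
    Real.cos_pos_of_mem_Ioo ⟨by linarith [hΘ.1, Real.pi_pos], hΘ.2⟩
  have hL : 0 ≤ net.L ell i ω := by unfold L; split_ifs <;> simp [hell]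
  have hw : weight α ell (net.mark i ω) =
      net.L ell i ω ^ (2 / α) * Real.cos (net.Θ i ω) ^ 2 := rfl
  have e2 : ∀ x : ℝ, 0 ≤ x → (x ^ 2) ^ (α / 2) = x ^ α := by
    intro x hx
    rw [← Real.rpow_natCast, ← Real.rpow_mul hx]
    congr 1; push_cast; ring
  have e3 : (2 / α) * (α / 2) = 1 := by field_simp
  rw [norm_U hΘ, gain, hw, Real.rpow_neg (by positivity), Real.div_rpow (norm_nonneg _) hcos.le,
    inv_div, Real.div_rpow (by positivity) (by positivity), e2 _ (norm_nonneg _),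
    Real.mul_rpow (by positivity) (by positivity), e2 _ hcos.le, ← Real.rpow_mul hL, e3,
    Real.rpow_one, mul_div_assoc]

variable [MeasurableSpace Ω] {μ : Measure Ω} {lam c₁ c₂ : ℝ}
  {ν : Measure ℝ} {N : ℕ}

lemma IsAPIL.integral_G (h : net.IsAPIL μ lam c₁ c₂ ν N) (i : ℕ) : ∫ ω, net.G i ω ∂μ = 1 := by
  rw [← integral_id_expMeasure_one, ← (h.law_G i).map_eq,
    integral_map (h.measurable_G i).aemeasurable measurable_id'.aestronglyMeasurable]

lemma IsAPIL.ae_G_pos (h : net.IsAPIL μ lam c₁ c₂ ν N) : ∀ᵐ ω ∂μ, ∀ i, 0 < net.G i ω := by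
  rw [ae_all_iff]
  intro i
  have := ae_pos_expMeasure one_pos
  rw [← (h.law_G i).map_eq] at this
  exact ae_of_ae_map (h.measurable_G i).aemeasurable this

lemma IsAPIL.ae_Gserv_pos (h : net.IsAPIL μ lam c₁ c₂ ν N) : ∀ᵐ ω ∂μ, 0 < net.Gserv ω := by
  have := ae_pos_gammaMeasure (a := N) (r := 1)
  rw [← h.law_Gserv.map_eq] at this
  exact ae_of_ae_map h.measurable_Gserv.aemeasurable this

lemma IsAPIL.ae_Θ_mem (h : net.IsAPIL μ lam c₁ c₂ ν N)
    (hν : ∀ᵐ θ ∂ν, θ ∈ Ico 0 (Real.pi / 2)) :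
    ∀ᵐ ω ∂μ, ∀ i, net.Θ i ω ∈ Ico 0 (Real.pi / 2) := by
  rw [ae_all_iff]
  intro i
  rw [← (h.law_Θ i).map_eq] at hν
  exact ae_of_ae_map (h.measurable_Θ i).aemeasurable hν

/-- The load of the typical user, the inverse of the ratio of the non-faded signal to the
interference plus noise. -/
noncomputable def userLoad (net : Network Ω) (α ell P σ₀ : ℝ) (ω : Ω) : ℝ≥0∞ :=
  IsPoissonGain.totalLoad (net.gain α ell) net.G (σ₀ / P) (α / 2) ω

/-- Dividing by the serving power normalizes distances by `1 / M`, with `M` the strongest gain. The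
strict test `(1 / M) * W j < 1` in the load removes exactly the serving index, because the maximum
is unique. -/
lemma interference_add_noise {α ell P σ₀ : ℝ} (hα : 0 < α)
    (hell : 0 ≤ ell) (hP : 0 < P) {ω : Ω} (hΘ : ∀ i, net.Θ i ω ∈ Ico 0 (Real.pi / 2))
    (hpos : 0 < net.gain α ell (net.star μ α ell P ω) ω)
    (hlt : ∀ j, j ≠ net.star μ α ell P ω →
        net.gain α ell j ω < net.gain α ell (net.star μ α ell P ω) ω) :
    net.interference μ α ell P ω + ENNReal.ofReal σ₀ =
      ENNReal.ofReal (P * net.gain α ell (net.star μ α ell P ω) ω ^ (α / 2)) *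
        net.userLoad α ell P σ₀ ω := by
  set i := net.star μ α ell P ω with hi
  set M := net.gain α ell i ω with hM
  have hle : ∀ j, net.gain α ell j ω ≤ net.gain α ell i ω := fun j => by
    rcases eq_or_ne j i with rfl | hj
    · exact le_rfl
    · exact (hlt j hj).le
  have hMp : 0 < M ^ (α / 2) := Real.rpow_pos_of_pos hpos _
  have hinv : M ^ (α / 2) * (1 / M) ^ (α / 2) = 1 := by
    rw [← Real.mul_rpow hpos.le (by positivity), mul_one_div_cancel hpos.ne', Real.one_rpow]
  rw [userLoad, IsPoissonGain.totalLoad, IsPoissonGain.load,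
    IsPoissonGain.maxGain_eq (i := i) (net.gain_nonneg hell i ω) hle, ← hM, mul_add, add_comm,
    ← ENNReal.tsum_mul_left]
  congr 1
  · rw [← ENNReal.ofReal_mul (by positivity)]
    congr 1
    rw [show P * M ^ (α / 2) * (σ₀ / P * (1 / M) ^ (α / 2)) =
      (P / P) * σ₀ * (M ^ (α / 2) * (1 / M) ^ (α / 2)) by ring, hinv, div_self hP.ne']
    ring
  · refine tsum_congr fun j => ?_
    rcases eq_or_ne j i with rfl | hj
    · rw [if_pos rfl, if_neg, mul_zero]
      change ¬ 1 / M * M < 1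
      rw [one_div_mul_cancel hpos.ne']
      exact lt_irrefl 1
    · have hj' : 1 / M * net.gain α ell j ω < 1 := by
        rw [one_div_mul_eq_div, div_lt_one hpos]; exact hlt j hj
      rw [if_neg hj, if_pos hj', ← ENNReal.ofReal_mul (by positivity)]
      congr 1
      rw [mul_assoc, L_mul_norm_U_rpow hα hell (hΘ j),
        Real.mul_rpow (by positivity) (net.gain_nonneg hell j ω)]
      linear_combination (-(P * net.G j ω * net.gain α ell j ω ^ (α / 2))) * hinv

/-- Interference plus noise may be `0` or `∞`, so clearing the denominator requires a signal that is
neither `0` nor `∞`; hence the positivity of the serving gain. -/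
lemma le_sinr_iff {α ell P σ₀ β : ℝ} (hα : 0 < α)
    (hell : 0 ≤ ell) (hP : 0 < P) {ω : Ω} (hΘ : ∀ i, net.Θ i ω ∈ Ico 0 (Real.pi / 2))
    (hpos : 0 < net.gain α ell (net.star μ α ell P ω) ω)
    (hlt : ∀ j, j ≠ net.star μ α ell P ω →
        net.gain α ell j ω < net.gain α ell (net.star μ α ell P ω) ω)
    (hG : 0 < net.Gserv ω) :
    ENNReal.ofReal β ≤ net.sinr μ α ell P σ₀ ω ↔
      ENNReal.ofReal β * net.userLoad α ell P σ₀ ω ≤ ENNReal.ofReal (net.Gserv ω) := by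
  have hK : 0 < P * net.gain α ell (net.star μ α ell P ω) ω ^ (α / 2) :=
    mul_pos hP (Real.rpow_pos_of_pos hpos _)
  have hsig : net.signal μ α ell P ω =
      P * net.gain α ell (net.star μ α ell P ω) ω ^ (α / 2) * net.Gserv ω := by
    rw [signal, mul_assoc, L_mul_norm_U_rpow hα hell (hΘ _)]; ring
  rw [sinr, interference_add_noise hα hell hP hΘ hpos hlt, hsig, ENNReal.le_div_iff_mul_le,
    ENNReal.ofReal_mul hK.le, mul_left_comm]
  · exact ENNReal.mul_le_mul_iff_right (ENNReal.ofReal_pos.2 hK).ne' ENNReal.ofReal_ne_top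
  · right; exact (ENNReal.ofReal_pos.2 (mul_pos hK hG)).ne'
  · right; exact ENNReal.ofReal_ne_top

lemma IsAPIL.measurable_userLoad (h : net.IsAPIL μ lam c₁ c₂ ν N) (α ell P σ₀ : ℝ) :
    Measurable (net.userLoad α ell P σ₀) :=
  IsPoissonGain.measurable_totalLoad (h.measurable_gain α ell) h.measurable_G _ _

/-- The load is a measurable function of the fading, projection and mark sequences. Reading
`totalLoad` on that product space yields measurability from the same general lemma. -/
lemma IsAPIL.indepFun_Gserv_userLoad (h : net.IsAPIL μ lam c₁ c₂ ν N) (α ell P σ₀ : ℝ) :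
    IndepFun net.Gserv (net.userLoad α ell P σ₀) μ := by
  let S := (ℕ → ℝ) × (ℕ → Plane) × (ℕ → ℝ × Bool)
  let W' : ℕ → S → ℝ := fun i z => weight α ell (z.2.2 i) / ‖z.2.1 i‖ ^ 2
  let G' : ℕ → S → ℝ := fun i z => z.1 i
  have hW' : ∀ i, Measurable (W' i) := fun i => by
    have h1 : Measurable fun z : S => z.2.2 i := by fun_prop
    have h2 : Measurable fun z : S => z.2.1 i := by fun_prop
    exact ((measurable_weight α ell).comp h1).div (h2.norm.pow_const 2)
  have hG' : ∀ i, Measurable (G' i) := fun i => (measurable_pi_apply i).comp measurable_fst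
  exact h.indep_Gserv_rest.comp measurable_id
    (IsPoissonGain.measurable_totalLoad hW' hG' (σ₀ / P) (α / 2))

lemma IsAPIL.avgPower_eq (h : net.IsAPIL μ lam c₁ c₂ ν N) {α ell P : ℝ} (hα : 0 < α)
    (hell : 0 ≤ ell) {ω : Ω} {i : ℕ} (hΘ : net.Θ i ω ∈ Ico 0 (Real.pi / 2)) :
    net.avgPower μ α ell P i ω = P * net.gain α ell i ω ^ (α / 2) := by
  rw [avgPower, h.integral_G i, mul_one, mul_assoc, L_mul_norm_U_rpow hα hell hΘ]

lemma IsAPIL.isStrongest_iff (h : net.IsAPIL μ lam c₁ c₂ ν N) {α ell P : ℝ} (hα : 0 < α)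
    (hell : 0 ≤ ell) (hP : 0 < P) {ω : Ω} (hΘ : ∀ i, net.Θ i ω ∈ Ico 0 (Real.pi / 2)) (i : ℕ) :
    net.IsStrongest μ α ell P ω i ↔ ∀ j, net.gain α ell j ω ≤ net.gain α ell i ω := by
  refine forall_congr' fun j => ?_
  rw [h.avgPower_eq hα hell (hΘ i), h.avgPower_eq hα hell (hΘ j), mul_le_mul_iff_right₀ hP,
    Real.rpow_le_rpow_iff (net.gain_nonneg hell j ω) (net.gain_nonneg hell i ω) (by positivity)]

variable [IsProbabilityMeasure μ]

lemma IsAPIL.isPoissonGain (h : net.IsAPIL μ lam c₁ c₂ ν N) {α ell : ℝ} (hlam : 0 < lam)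
    (hell : ell ∈ Icc (0 : ℝ) 1) (hc₂ : 0 < c₂) :
    IsPoissonGain μ (net.gain α ell) net.G (Real.pi * lam * omega α ell c₁ c₂ ν) where
  measurable_W := h.measurable_gain α ell
  measurable_G := h.measurable_G
  nonneg := net.gain_nonneg hell.1
  laplace _ hF hF0 := h.lintegral_expNeg_tsum hlam hell hc₂ hF hF0

/-- Almost surely the serving index is the unique strongest one. -/
lemma IsAPIL.ae_existsUnique_isStrongest (h : net.IsAPIL μ lam c₁ c₂ ν N) {α ell P : ℝ}
    (hα : 0 < α) (hlam : 0 < lam) (hell : ell ∈ Icc (0 : ℝ) 1) (hc₂ : 0 < c₂) (hP : 0 < P)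
    (hν : ∀ᵐ θ ∂ν, θ ∈ Ico 0 (Real.pi / 2)) (hω : 0 < omega α ell c₁ c₂ ν) :
    ∀ᵐ ω ∂μ, (∃! i, net.IsStrongest μ α ell P ω i) ∧
      0 < net.gain α ell (net.star μ α ell P ω) ω ∧
      ∀ j, j ≠ net.star μ α ell P ω →
        net.gain α ell j ω < net.gain α ell (net.star μ α ell P ω) ω := by
  have hc : 0 < Real.pi * lam * omega α ell c₁ c₂ ν := by positivity
  filter_upwards [(h.isPoissonGain (α := α) hlam hell hc₂).ae_exists_max hc, h.ae_Θ_mem hν] with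
    ω ⟨i, hi, hlt⟩ hΘ
  have hiff := h.isStrongest_iff (P := P) hα hell.1 hP hΘ
  have hle : ∀ j, net.gain α ell j ω ≤ net.gain α ell i ω := fun j => by
    rcases eq_or_ne j i with rfl | hj
    · exact le_rfl
    · exact (hlt j hj).le
  have huniq : ∀ j, net.IsStrongest μ α ell P ω j → j = i := by
    intro j hj
    by_contra hne
    exact absurd ((hiff j).1 hj i) (not_le.2 (hlt j hne))
  have hstar : net.star μ α ell P ω = i :=
    huniq _ (Classical.epsilon_spec (p := net.IsStrongest μ α ell P ω) ⟨i, (hiff i).2 hle⟩)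
  rw [hstar]
  exact ⟨⟨i, (hiff i).2 hle, huniq⟩, hi, hlt⟩

/-! ### Coverage probability and the final formula -/

/-- The coverage probability as a mean of tails of the law of the serving gain. -/
lemma IsAPIL.coverage_eq_meanTail {m : ℕ} (h : net.IsAPIL μ lam c₁ c₂ ν (m + 1))
    {α ell P σ₀ β : ℝ}
    (hα : 0 < α) (hlam : 0 < lam) (hell : ell ∈ Icc (0 : ℝ) 1) (hc₂ : 0 < c₂) (hP : 0 < P)
    (hβ : 0 < β) (hν : ∀ᵐ θ ∂ν, θ ∈ Ico 0 (Real.pi / 2)) (hω : 0 < omega α ell c₁ c₂ ν) :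
    net.coverage μ α ell P σ₀ β = meanTail (μ.restrict {ω | net.userLoad α ell P σ₀ ω ≠ ∞})
      (fun ω => (net.userLoad α ell P σ₀ ω).toReal) m (1 / β) := by
  set T := net.userLoad α ell P σ₀ with hT
  have hTm : Measurable T := h.measurable_userLoad α ell P σ₀
  have hfin : MeasurableSet {ω | T ω ≠ ∞} := (hTm (measurableSet_singleton ∞)).compl
  have h1 : μ {ω | ENNReal.ofReal β ≤ net.sinr μ α ell P σ₀ ω} =
      μ {ω | ENNReal.ofReal β * T ω ≤ ENNReal.ofReal (net.Gserv ω)} := by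
    refine measure_congr ?_
    filter_upwards [h.ae_existsUnique_isStrongest hα hlam hell hc₂ hP hν hω, h.ae_Θ_mem hν,
      h.ae_Gserv_pos] with ω ⟨_, hpos, hlt⟩ hΘ hG
    exact propext (le_sinr_iff hα hell.1 hP hΘ hpos hlt hG)
  have hA : MeasurableSet {q : ℝ × ℝ≥0∞ | ENNReal.ofReal β * q.2 ≤ ENNReal.ofReal q.1} :=
    measurableSet_le (by fun_prop) (by fun_prop)
  have h2 : μ {ω | ENNReal.ofReal β * T ω ≤ ENNReal.ofReal (net.Gserv ω)} =
      ∫⁻ ω, gammaMeasure ((m + 1 : ℕ) : ℝ) 1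
        {g | ENNReal.ofReal β * T ω ≤ ENNReal.ofReal g} ∂μ := by
    have e := (indepFun_iff_map_prod_eq_prod_map_map h.measurable_Gserv.aemeasurable
      hTm.aemeasurable).1 (h.indepFun_Gserv_userLoad α ell P σ₀)
    have hp1 := Measure.isProbabilityMeasure_map (μ := μ) h.measurable_Gserv.aemeasurable
    have hp2 := Measure.isProbabilityMeasure_map (μ := μ) hTm.aemeasurable
    calc _ = (μ.map fun ω => (net.Gserv ω, T ω))
          {q : ℝ × ℝ≥0∞ | ENNReal.ofReal β * q.2 ≤ ENNReal.ofReal q.1} :=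
          (Measure.map_apply (h.measurable_Gserv.prodMk hTm) hA).symm
      _ = _ := by
        rw [e, Measure.prod_apply_symm hA, lintegral_map (measurable_measure_prodMk_right hA) hTm,
          h.law_Gserv.map_eq]
        rfl
  -- An infinite load has coverage probability `0`, so restricting `μ` to finite loads loses
  -- nothing. The argument `1 / β` of `meanTail` appears because `β y = y / (1 / β)`.
  have h3 : ∀ ω, gammaMeasure ((m + 1 : ℕ) : ℝ) 1
      {g | ENNReal.ofReal β * T ω ≤ ENNReal.ofReal g} = {ω | T ω ≠ ∞}.indicator
        (fun ω => ENNReal.ofReal (gammaTail m ((T ω).toReal / (1 / β)))) ω := by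
    intro ω
    by_cases hω' : T ω = ∞
    · rw [indicator_of_notMem (by simpa using hω'), hω',
        ENNReal.mul_top (ENNReal.ofReal_pos.2 hβ).ne']
      simp
    · rw [indicator_of_mem (by exact hω'), ← gammaMeasure_ofReal_le m (by positivity)]
      congr 1
      ext g
      rw [mem_ofPred_eq, mem_ofPred_eq, one_div, div_inv_eq_mul, ENNReal.ofReal_mul
        ENNReal.toReal_nonneg, ENNReal.ofReal_toReal hω', mul_comm (T ω)]
  rw [coverage, measureReal_def, h1, h2, meanTail, integral_eq_lintegral_of_nonneg_ae]
  · simp_rw [h3]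
    rw [lintegral_indicator hfin]
  · exact ae_of_all _ fun ω => gammaTail_nonneg m (by positivity)
  · exact Measurable.aestronglyMeasurable (by fun_prop)

/-- For index `0` the tail is `exp (-y)`, so this is the Laplace transform of the load with `u = 1 /
t`, `κ = σ₀ / P` and `p = α / 2`. Infinite loads contribute `exp (-∞) = 0` and may be dropped; `α >
2` is the condition `p > 1`. -/
lemma IsAPIL.meanTail_zero (h : net.IsAPIL μ lam c₁ c₂ ν N) {α ell P σ₀ : ℝ}
    (hα : 2 < α) (hlam : 0 < lam) (hell : ell ∈ Icc (0 : ℝ) 1) (hc₂ : 0 < c₂) (hP : 0 < P)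
    (hσ₀ : 0 ≤ σ₀) (hω : 0 < omega α ell c₁ c₂ ν) {t : ℝ} (ht : 0 < t) :
    meanTail (μ.restrict {ω | net.userLoad α ell P σ₀ ω ≠ ∞})
      (fun ω => (net.userLoad α ell P σ₀ ω).toReal) 0 t =
      ∫ D, Real.exp (-(σ₀ * D ^ (α / 2)) / (t * P) -
        Real.pi * lam * omega α ell c₁ c₂ ν * D * IG (1 / t) (2 / α))
        ∂(expMeasure (Real.pi * lam * omega α ell c₁ c₂ ν)) := by
  set T := net.userLoad α ell P σ₀ with hT
  have hTm : Measurable T := h.measurable_userLoad α ell P σ₀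
  have hfin : MeasurableSet {ω | T ω ≠ ∞} := (hTm (measurableSet_singleton ∞)).compl
  have hc : 0 < Real.pi * lam * omega α ell c₁ c₂ ν := by positivity
  have hlap := (h.isPoissonGain (α := α) hlam hell hc₂).lintegral_expNeg_totalLoad hc
    (by filter_upwards [h.ae_G_pos] with ω hG i using (hG i).le) (u := 1 / t) (κ := σ₀ / P)
    (p := α / 2) (by positivity) (by positivity) (by linarith)
  rw [meanTail, integral_eq_lintegral_of_nonneg_ae
    (ae_of_all _ fun ω => gammaTail_nonneg 0 (by positivity))
    (Measurable.aestronglyMeasurable (by fun_prop)),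
    integral_eq_lintegral_of_nonneg_ae (ae_of_all _ fun ω => (Real.exp_pos _).le)
    (Measurable.aestronglyMeasurable (by fun_prop))]
  congr 1
  rw [← lintegral_indicator hfin]
  have e1 : ∀ ω, {ω | T ω ≠ ∞}.indicator
      (fun ω => ENNReal.ofReal (gammaTail 0 ((T ω).toReal / t))) ω =
      expNeg (ENNReal.ofReal (1 / t) * T ω) := by
    intro ω
    by_cases hω' : T ω = ∞
    · rw [indicator_of_notMem (by simpa using hω'), hω',
        ENNReal.mul_top (ENNReal.ofReal_pos.2 (by positivity)).ne', expNeg_top]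
    · rw [indicator_of_mem (by exact hω'), expNeg_of_ne_top
        (ENNReal.mul_ne_top ENNReal.ofReal_ne_top hω'), ENNReal.toReal_mul,
        ENNReal.toReal_ofReal (by positivity)]
      simp [gammaTail, poissonWeight, div_eq_inv_mul]
  simp_rw [e1]
  refine hlap.trans (lintegral_congr fun D => ?_)
  rw [one_div_div]
  congr 3
  field_simp

end Network

lemma integrable_covIntegrand {N : ℕ} {α lam P σ₀ w t : ℝ} (hα : 2 < α) (hP : 0 < P)
    (hσ₀ : 0 ≤ σ₀) (hc : 0 < Real.pi * lam * w) (ht : 0 < t) :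
    Integrable (covIntegrand N α lam P σ₀ w t) (expMeasure (Real.pi * lam * w)) := by
  have := isProbabilityMeasure_expMeasure hc
  refine Integrable.of_bound (C := t ^ (N - 1) / ((N - 1).factorial : ℝ))
    (Measurable.aestronglyMeasurable (by unfold covIntegrand; fun_prop)) ?_
  filter_upwards [ae_pos_expMeasure hc] with D hD
  have hIG : 0 ≤ IG (1 / t) (2 / α) := by
    have := IG_nonneg (u := 1 / t) (p := α / 2) (by positivity) (by linarith)
    rwa [one_div_div] at this
  rw [covIntegrand, Real.norm_of_nonneg (by positivity)]
  refine mul_le_of_le_one_right (by positivity) (Real.exp_le_one_iff.2 ?_)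
  have h1 : -(σ₀ * D ^ (α / 2)) / (t * P) ≤ 0 :=
    div_nonpos_of_nonpos_of_nonneg (neg_nonpos.2 (by positivity)) (by positivity)
  have h2 : 0 ≤ Real.pi * lam * w * D * IG (1 / t) (2 / α) := by positivity
  linarith

end UAVNet

open UAVNet

theorem proposition1 {Ω : Type*} [MeasurableSpace Ω] (μ : Measure Ω) [IsProbabilityMeasure μ]
    (α ell lam c₁ c₂ P σ₀ β : ℝ) (N : ℕ) (ν : Measure ℝ) (net : UAVNet.Network Ω)
    (hα : 2 < α) (hell : ell ∈ Set.Icc (0 : ℝ) 1) (hlam : 0 < lam) (hc₁ : 0 < c₁) (hc₂ : 0 < c₂)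
    (hP : 0 < P) (hσ₀ : 0 ≤ σ₀) (hβ : 0 < β) (hN : 1 ≤ N)
    (hν : ∀ᵐ θ ∂ν, θ ∈ Set.Ico 0 (Real.pi / 2))
    (hnet : net.IsAPIL μ lam c₁ c₂ ν N) :
    0 < UAVNet.omega α ell c₁ c₂ ν ∧
    (∀ᵐ ω ∂μ, ∃! i, net.IsStrongest μ α ell P ω i) ∧
    (∀ t : ℝ, 0 < t →
      Integrable (UAVNet.covIntegrand N α lam P σ₀ (UAVNet.omega α ell c₁ c₂ ν) t)
        (expMeasure (Real.pi * lam * UAVNet.omega α ell c₁ c₂ ν))) ∧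
    ContDiffOn ℝ ((N - 1 : ℕ) : WithTop ℕ∞)
      (UAVNet.covExpectation N α lam P σ₀ (UAVNet.omega α ell c₁ c₂ ν)) (Set.Ioi 0) ∧
    net.coverage μ α ell P σ₀ β =
      iteratedDeriv (N - 1)
        (UAVNet.covExpectation N α lam P σ₀ (UAVNet.omega α ell c₁ c₂ ν)) (1 / β) := by
  obtain ⟨m, rfl⟩ : ∃ m, N = m + 1 := ⟨N - 1, by omega⟩
  have hα0 : 0 < α := by linarith
  have hprob := hnet.isProbabilityMeasure
  have hω : 0 < omega α ell c₁ c₂ ν := omega_pos hell hα0 hc₂ hν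
  set T := net.userLoad α ell P σ₀ with hT
  set μ' := μ.restrict {ω | T ω ≠ ∞} with hμ'
  have hY : Measurable fun ω => (T ω).toReal :=
    (hnet.measurable_userLoad α ell P σ₀).ennreal_toReal
  have hY0 : ∀ ω, 0 ≤ (T ω).toReal := fun ω => ENNReal.toReal_nonneg
  -- The two functions are identified for `t > 0` only. Since `(0, ∞)` is open, smoothness and
  -- iterated derivatives still transfer.
  have hcov : EqOn (covExpectation (m + 1) α lam P σ₀ (omega α ell c₁ c₂ ν))
      (fun s => s ^ m / (m.factorial : ℝ) * meanTail μ' (fun ω => (T ω).toReal) 0 s) (Ioi 0) := by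
    intro t ht
    simp only [hμ', hT]
    rw [hnet.meanTail_zero hα hlam hell hc₂ hP hσ₀ hω ht, ← integral_const_mul]
    rfl
  refine ⟨hω, ?_, fun t ht => integrable_covIntegrand hα hP hσ₀ (by positivity) ht, ?_, ?_⟩
  · filter_upwards [hnet.ae_existsUnique_isStrongest hα0 hlam hell hc₂ hP hν hω] with ω h using h.1
  · refine ContDiffOn.congr ?_ hcov
    exact ContDiffOn.mul (by fun_prop) (contDiffOn_meanTail hY hY0 _ 0)
  · rw [hnet.coverage_eq_meanTail hα0 hlam hell hc₂ hP hβ hν hω, Nat.add_sub_cancel,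
      hcov.iteratedDeriv_of_isOpen isOpen_Ioi m (by simpa using hβ : 1 / β ∈ Ioi 0),
      iteratedDeriv_pow_mul_meanTail hY hY0 m _ (by positivity)]
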